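/- Let $p$ be a prime, $G$ a finite $p$-group and $R$ a commutative ring with unity. **Notation.** A section of $G$ is a pair $(U,V)$ of subgroups with $V\trianglelefteq U\le G$, and $(U,V)\preceq(M,L)$ means $L\le V\le U\le M$. The orbit category of sections $\mathcal D_G$ has the sections of $G$ as objects, the cosets $Mg$ with $g\in G$, ${}^g(U,V)\preceq (M,L)$, as morphisms $(U,V)\to(M,L)$, and composition $Nh\circ Mg=Nhg$. Let $\mathcal D^*_G$ and $\mathcal D^c_G$ be its full subcategories on the sections $(U,V)$ with $V\ne1$, respectively on the sections $(C_G(E),E)$ with $E\neq 1$ an elementary abelian $p$-subgroup of $G$. Let $\mathcal A'_p(G)$ be the category of all elementary abelian $p$-subgroups of $G$ (including $1$), whose morphisms $E_1\to E_2$ are the homomorphisms $x\mapsto gxg^{-1}$ with $g\in G$, ${}^gE_1\le E_2$; the Quillen category $\mathcal A_p(G)$ is its full subcategory on the nontrivial subgroups. An $R\mathcal D_G$-module is a contravariant functor $F$ from $\mathcal D_G$ to $R$-modules, with values written $F(U/V)$, and $F(G):=F(G/1)$. A destriction functor for $G$ over $R$ (a module over the destriction algebra of $G$) and a biset functor for $G$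 over $R$ are regarded as $R\mathcal D_G$-modules by letting the coset $Mg:(U,V)\to(M,L)$ act as the destriction from $M/L$ to ${}^gU/{}^gV$ followed by conjugation by $g^{-1}$. For an $R\mathcal D_G$-module $F$, let $\overline F$ be the covariant $R\mathcal A'_p(G)$-module $\overline F(E)=F(C_G(E)/E)$, on which $x\mapsto gxg^{-1}:E_1\to E_2$ acts through the coset $C_G(E_1)g^{-1}:(C_G(E_2),E_2)\to(C_G(E_1),E_1)$. The reduced cohomology $\widetilde H^n(\mathcal D^*_G;F)$ is $\mathrm{Ext}^n_{R\mathcal D^*_G}(\underline R,F)$ for $n\ge1$, and in degrees $n=-1$ and $n=0$ the kernel and the cokernel of the map $F(G)\to\varprojlim_{(U,V)\in\mathcal D^*_G}F(U/V)$ given by the destrictions. For an $R\mathcal A'_p(G)$-module $M$, $\widetilde H^*(\mathcal A_p(G);M)$ is the cohomology of the cochain complex obtained by applying $\mathrm{Hom}_{R\mathcal A'_p(G)}(-,M)$ to $\cdots\to P_1\to P_0\to\underline R\to0$, where $P_*$ is a projective resolution of the constant functor of $\mathcal A_p(G)$, extended by zero to the trivial subgroup, $\underline R$ is the constant functor of $\mathcal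 A'_p(G)$, and $\mathrm{Hom}(\underline R,M)$ is placed in degree $-1$. Both reduced cohomologies are zero in degrees $n<-1$. A gluing data for $F(G)$ is a family $f_H\in F(N_G(H)/H)$, $1<H\le G$, with ${}^gf_H=f_{{}^gH}$ for all $g\in G$, and such that $f_K$ and $f_H$ have the same destriction in $F\bigl((N_G(H)\cap N_G(K))/H\bigr)$ whenever $1<K\trianglelefteq H\le G$; $\mathrm{Obs}(F(G))$ is the cokernel of the map from $F(G)$ to the $R$-module of gluing data, $f\mapsto(\mathrm{Defres}^G_{N_G(H)/H}f)_H$. **Theorem.** (1) The functor $E\mapsto(C_G(E),E)$, which sends $x\mapsto gxg^{-1}:E_1\to E_2$ to the coset $C_G(E_1)g^{-1}$, is an isomorphism of categories from $\mathcal A_p(G)$ to the opposite of $\mathcal D^c_G$. (2) For every $R\mathcal D_G$-module $F$, in particular for every destriction functor and every biset functor $F$ for $G$ over $R$, and for every integer $n$, there is an isomorphism of $R$-modules $$\widetilde H^n(\mathcal D^*_G;F)\cong\widetilde H^n(\mathcal A_p(G);\overline F).$$ (3) In particular, for such $F$, there is an isomorphism of $R$-modules $\mathrm{Obs}(F(G))\cong\widetilde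 H^0(\mathcal A_p(G);\overline F)$. -/

import Mathlib

open CategoryTheory Limits Opposite
open scoped Pointwise

universe u

namespace SectionGluing

noncomputable section

/-! ### Sections of a group and the orbit category of sections -/

/-- A section `(U, V)` of `G`: subgroups `V ⊴ U ≤ G`. -/
@[ext]
structure Sec (G : Type u) [Group G] where
  U : Subgroup G
  V : Subgroup G
  le : V ≤ U
  normal : (V.subgroupOf U).Normal

namespace Sec

variable {G : Type u} [Group G]

/-- `(U, V) ≼ (M, L)` if and only if `L ≤ V ≤ U ≤ M`. -/
instance : LE (Sec G) := ⟨fun S T => T.V ≤ S.V ∧ S.U ≤ T.U⟩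

theorem le_refl' (S : Sec G) : S ≤ S := ⟨le_rfl, le_rfl⟩

theorem le_trans' {S T W : Sec G} (h : S ≤ T) (h' : T ≤ W) : S ≤ W :=
  ⟨h'.1.trans h.1, h.2.trans h'.2⟩

theorem conj_mem (S : Sec G) {u v : G} (hu : u ∈ S.U) (hv : v ∈ S.V) : u * v * u⁻¹ ∈ S.V := by
  have := S.normal.conj_mem ⟨v, S.le hv⟩ (Subgroup.mem_subgroupOf.2 hv) ⟨u, hu⟩
  exact Subgroup.mem_subgroupOf.1 this

/-- A constructor for sections. -/
def of (U V : Subgroup G) (h : V ≤ U) (h' : ∀ u ∈ U, ∀ v ∈ V, u * v * u⁻¹ ∈ V) : Sec G where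
  U := U
  V := V
  le := h
  normal := ⟨fun v hv u => Subgroup.mem_subgroupOf.2 (h' u u.2 v (Subgroup.mem_subgroupOf.1 hv))⟩

theorem mem_smul_subgroup {g x : G} {U : Subgroup G} :
    x ∈ MulAut.conj g • U ↔ g⁻¹ * x * g ∈ U := by
  rw [Subgroup.mem_pointwise_smul_iff_inv_smul_mem, ← map_inv, MulAut.smul_def,
    MulAut.conj_apply, inv_inv]

/-- `G` acts on its sections by conjugation: `g • (U, V) = (g U g⁻¹, g V g⁻¹)`. -/
instance : MulAction G (Sec G) where
  smul g S := of (MulAut.conj g • S.U) (MulAut.conj g • S.V)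
    (fun x hx => by
      rw [mem_smul_subgroup] at hx ⊢
      exact S.le hx)
    (fun u hu v hv => by
      rw [mem_smul_subgroup] at hu hv ⊢
      have := S.conj_mem hu hv
      simpa [mul_assoc] using this)
  one_smul S := by
    refine Sec.ext ?_ ?_
    · change MulAut.conj 1 • S.U = S.U
      rw [map_one, one_smul]
    · change MulAut.conj 1 • S.V = S.V
      rw [map_one, one_smul]
  mul_smul g h S := by
    refine Sec.ext ?_ ?_
    · change MulAut.conj (g * h) • S.U = MulAut.conj g • MulAut.conj h • S.U
      rw [map_mul, mul_smul]
    · change MulAut.conj (g * h) • S.V = MulAut.conj g • MulAut.conj h • S.V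
      rw [map_mul, mul_smul]

theorem mem_smul_U {g x : G} {S : Sec G} : x ∈ (g • S).U ↔ g⁻¹ * x * g ∈ S.U :=
  mem_smul_subgroup

theorem mem_smul_V {g x : G} {S : Sec G} : x ∈ (g • S).V ↔ g⁻¹ * x * g ∈ S.V :=
  mem_smul_subgroup

theorem smul_le_smul (g : G) {S T : Sec G} (h : S ≤ T) : g • S ≤ g • T :=
  ⟨fun _ hx => mem_smul_V.2 (h.1 (mem_smul_V.1 hx)), fun _ hx => mem_smul_U.2 (h.2 (mem_smul_U.1 hx))⟩

theorem smul_eq_of_mem {S : Sec G} {m : G} (hm : m ∈ S.U) : m • S = S := by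
  refine Sec.ext (Subgroup.ext fun x => ?_) (Subgroup.ext fun x => ?_)
  · rw [mem_smul_U, Subgroup.mul_mem_cancel_right _ hm,
      Subgroup.mul_mem_cancel_left _ (inv_mem hm)]
  · rw [mem_smul_V]
    constructor
    · intro h
      have := S.conj_mem hm h
      simpa [mul_assoc] using this
    · intro h
      have := S.conj_mem (inv_mem hm) h
      simpa [mul_assoc] using this

instance [Finite G] : Finite (Sec G) :=
  Finite.of_injective (fun S : Sec G => (S.U, S.V)) fun S T h => by
    simp only [Prod.mk.injEq] at h
    exact Sec.ext h.1 h.2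

/-- The subquotient `U / V` of a section `(U, V)`. -/
abbrev Quot (S : Sec G) : Type u := S.U ⧸ S.V.subgroupOf S.U

instance (S : Sec G) : (S.V.subgroupOf S.U).Normal := S.normal

/-- `g` and `g'` define the same coset `M g = M g'`. -/
def cosetSetoid (S T : Sec G) : Setoid {g : G // g • S ≤ T} where
  r g g' := ∃ m ∈ T.U, (g' : G) = m * g
  iseqv :=
    ⟨fun g => ⟨1, one_mem _, by simp⟩,
     fun {g g'} ⟨m, hm, h⟩ => ⟨m⁻¹, inv_mem hm, by simp [h]⟩,
     fun {g g' g''} ⟨m, hm, h⟩ ⟨m', hm', h'⟩ => ⟨m' * m, mul_mem hm' hm, by simp [h, h', mul_assoc]⟩⟩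

/-- The morphisms `(U, V) ⟶ (M, L)` in the orbit category of sections: the cosets `M g` of the
elements `g` with `g • (U, V) ≼ (M, L)`. -/
def Hom (S T : Sec G) : Type u := Quotient (cosetSetoid S T)

/-- The coset `M g` as a morphism `(U, V) ⟶ (M, L)`. -/
def coset {S T : Sec G} (g : G) (h : g • S ≤ T) : Hom S T := Quotient.mk (cosetSetoid S T) ⟨g, h⟩

theorem coset_eq {S T : Sec G} {g g' : G} (h : g • S ≤ T) (h' : g' • S ≤ T) {m : G} (hm : m ∈ T.U)
    (e : g' = m * g) : coset g h = coset g' h' :=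
  Quotient.sound (s := cosetSetoid S T) ⟨m, hm, e⟩

theorem mul_smul_le {S T W : Sec G} {g h : G} (hg : g • S ≤ T) (hh : h • T ≤ W) :
    (h * g) • S ≤ W := by
  rw [mul_smul]
  exact le_trans' (smul_le_smul h hg) hh

/-- The composition `N h ∘ M g = N h g`. -/
def Hom.comp {S T W : Sec G} : Hom S T → Hom T W → Hom S W :=
  Quotient.map₂ (fun g h => ⟨h.1 * g.1, mul_smul_le g.2 h.2⟩) (by
    rintro ⟨g, hg⟩ ⟨g', hg'⟩ ⟨m, hm, e⟩ ⟨h, hh⟩ ⟨h', hh'⟩ ⟨n, hn, e'⟩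
    have hm' : h * m * h⁻¹ ∈ W.U := hh.2 (mem_smul_U.2 (by simpa [mul_assoc] using hm))
    dsimp only at e e'
    exact ⟨n * (h * m * h⁻¹), mul_mem hn hm', by simp [e, e', mul_assoc]⟩)

/-- The orbit category of sections `𝒟_G`, over all sections of `G`. -/
instance : SmallCategory (Sec G) where
  Hom := Hom
  id S := coset 1 (by rw [one_smul]; exact le_refl' S)
  comp := Hom.comp
  id_comp := by
    rintro S T ⟨g, hg⟩
    exact coset_eq _ _ (one_mem _) (by simp)
  comp_id := by
    rintro S T ⟨g, hg⟩
    exact coset_eq _ _ (one_mem _) (by simp)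
  assoc := by
    rintro S T W X ⟨g, hg⟩ ⟨h, hh⟩ ⟨k, hk⟩
    exact coset_eq _ _ (one_mem _) (by simp [mul_assoc])

/-- The coset `M g` as a morphism of the orbit category of sections. -/
def homOf {S T : Sec G} (g : G) (h : g • S ≤ T) : S ⟶ T := coset g h

theorem homOf_comp {S T W : Sec G} {g h : G} (hg : g • S ≤ T) (hh : h • T ≤ W) :
    homOf g hg ≫ homOf h hh = homOf (h * g) (mul_smul_le hg hh) := rfl

/-- The morphism given by an inclusion of sections; it induces the destriction map. -/
def incl {S T : Sec G} (h : S ≤ T) : S ⟶ T := homOf 1 (by rwa [one_smul])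

/-- The section `(G, 1)`. -/
def whole (G : Type u) [Group G] : Sec G :=
  of ⊤ ⊥ bot_le fun u _ v hv => by simp [Subgroup.mem_bot.1 hv]

theorem le_whole (S : Sec G) : S ≤ whole G := ⟨bot_le, le_top⟩

end Sec

open Sec

/-- The collection of all sections `(U, V)` with `V ≠ 1`. -/
def starCollection (G : Type u) [Group G] : ObjectProperty (Sec G) := fun S => S.V ≠ ⊥

/-- The full subcategory `𝒟*_G` of `𝒟_G` over all sections `(U, V)` with `V ≠ 1`. -/
abbrev DStar (G : Type u) [Group G] : Type u := (starCollection G).FullSubcategory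

/-- The inclusion `𝒟*_G ⥤ 𝒟_G`. -/
abbrev DStar.ι (G : Type u) [Group G] : DStar G ⥤ Sec G := (starCollection G).ι

/-! ### The Quillen category -/

/-- The elementary abelian `p`-subgroups of `G`, the trivial subgroup included. -/
structure IsElemAb (p : ℕ) {G : Type u} [Group G] (E : Subgroup G) : Prop where
  comm : ∀ x ∈ E, ∀ y ∈ E, x * y = y * x
  pow : ∀ x ∈ E, x ^ p = 1

/-- The objects of the Quillen category `𝒜'_p(G)`: all elementary abelian `p`-subgroups of `G`,
the trivial subgroup included. -/
structure QuillenCat (p : ℕ) (G : Type u) [Group G] where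
  E : Subgroup G
  elemAb : IsElemAb p E

namespace QuillenCat

variable {p : ℕ} {G : Type u} [Group G]

/-- The group homomorphisms `E₁ → E₂` that are compositions of conjugations by elements of `G`
and inclusions, that is, those of the form `x ↦ g x g⁻¹`. -/
def Hom (A B : QuillenCat p G) : Type u :=
  {φ : A.E →* B.E // ∃ g : G, ∀ x : A.E, (φ x : G) = g * x * g⁻¹}

instance : SmallCategory (QuillenCat p G) where
  Hom := Hom
  id A := ⟨MonoidHom.id _, 1, by simp⟩
  comp φ ψ := ⟨ψ.1.comp φ.1, by
    obtain ⟨φ, g, hg⟩ := φ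
    obtain ⟨ψ, h, hh⟩ := ψ
    exact ⟨h * g, fun x => by simp [hh, hg, mul_assoc]⟩⟩

/-- The trivial subgroup as an object of `𝒜'_p(G)`. -/
def trivial (p : ℕ) (G : Type u) [Group G] : QuillenCat p G where
  E := ⊥
  elemAb := ⟨fun x hx y hy => by simp [Subgroup.mem_bot.1 hx, Subgroup.mem_bot.1 hy],
    fun x hx => by simp [Subgroup.mem_bot.1 hx]⟩

/-- The section `(C_G(E), E)`. -/
def centSec (A : QuillenCat p G) : Sec G :=
  Sec.of (Subgroup.centralizer (A.E : Set G)) A.E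
    (fun x hx => Subgroup.mem_centralizer_iff.2 fun y hy => A.elemAb.comm y hy x hx)
    (fun u hu v hv => by
      have := Subgroup.mem_centralizer_iff.1 hu v hv
      rwa [← this, mul_inv_cancel_right])

theorem centSec_le {A B : QuillenCat p G} {φ : A.E →* B.E} {g : G}
    (h : ∀ x : A.E, (φ x : G) = g * x * g⁻¹) : g⁻¹ • centSec B ≤ centSec A := by
  constructor
  · intro x hx
    rw [mem_smul_V, inv_inv]
    have := (φ ⟨x, hx⟩).2
    rw [h] at this
    exact this
  · intro c hc
    rw [mem_smul_U, inv_inv] at hc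
    refine Subgroup.mem_centralizer_iff.2 fun x hx => ?_
    have h1 := (φ ⟨x, hx⟩).2
    rw [h] at h1
    have h2 := Subgroup.mem_centralizer_iff.1 hc _ h1
    simp only [mul_assoc, inv_mul_cancel_left, mul_right_inj] at h2
    simpa only [← mul_assoc, mul_left_inj] using h2

theorem coset_unique {A B : QuillenCat p G} {φ : A.E →* B.E} {g g' : G}
    (h : ∀ x : A.E, (φ x : G) = g * x * g⁻¹) (h' : ∀ x : A.E, (φ x : G) = g' * x * g'⁻¹) :
    homOf g⁻¹ (centSec_le h) = homOf g'⁻¹ (centSec_le h') := by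
  refine coset_eq _ _ (m := g'⁻¹ * g) (Subgroup.mem_centralizer_iff.2 fun x hx => ?_) (by group)
  have e : g * x * g⁻¹ = g' * x * g'⁻¹ := (h ⟨x, hx⟩).symm.trans (h' ⟨x, hx⟩)
  calc x * (g'⁻¹ * g) = g'⁻¹ * (g' * x * g'⁻¹) * g := by group
    _ = g'⁻¹ * (g * x * g⁻¹) * g := by rw [e]
    _ = g'⁻¹ * g * x := by group

/-- An element `g` of `G` such that the given morphism of `𝒜'_p(G)` is `x ↦ g x g⁻¹`. -/
def elt {A B : QuillenCat p G} (φ : A ⟶ B) : G := φ.2.choose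

theorem elt_spec {A B : QuillenCat p G} (φ : A ⟶ B) (x : A.E) :
    (φ.1 x : G) = elt φ * x * (elt φ)⁻¹ := φ.2.choose_spec x

/-- The functor `𝒜'_p(G) ⥤ (𝒟_G)ᵒᵖ` that sends `E` to `(C_G(E), E)`, and the map
`x ↦ g x g⁻¹ : E₁ → E₂` to the coset `C_G(E₁) g⁻¹ : (C_G(E₂), E₂) ⟶ (C_G(E₁), E₁)`, which does not
depend on the choice of `g`. -/
def toSec (p : ℕ) (G : Type u) [Group G] : QuillenCat p G ⥤ (Sec G)ᵒᵖ where
  obj A := op (centSec A)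
  map φ := (homOf (elt φ)⁻¹ (centSec_le (elt_spec φ))).op
  map_id A := by
    have h : ∀ x : A.E, ((MonoidHom.id A.E) x : G) = 1 * x * 1⁻¹ := by simp
    refine congrArg Quiver.Hom.op ((coset_unique (elt_spec (𝟙 A)) h).trans ?_)
    exact coset_eq _ _ (one_mem _) (by simp)
  map_comp {A B C} φ ψ := by
    have h : ∀ x : A.E, ((φ ≫ ψ).1 x : G) = (elt ψ * elt φ) * x * (elt ψ * elt φ)⁻¹ := fun x => by
      refine (elt_spec ψ (φ.1 x)).trans ?_
      rw [elt_spec φ]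
      group
    refine congrArg Quiver.Hom.op ((coset_unique (elt_spec (φ ≫ ψ)) h).trans ?_)
    exact coset_eq _ _ (one_mem _) (by simp)

end QuillenCat

/-- The collection of the nontrivial elementary abelian `p`-subgroups. -/
def nontrivialElemAb (p : ℕ) (G : Type u) [Group G] : ObjectProperty (QuillenCat p G) :=
  fun A => A.E ≠ ⊥

/-- The Quillen category `𝒜_p(G)`: the full subcategory of the nontrivial elementary abelian
`p`-subgroups of `G`. -/
abbrev Quillen (p : ℕ) (G : Type u) [Group G] : Type u := (nontrivialElemAb p G).FullSubcategory

/-- The inclusion `𝒜_p(G) ⥤ 𝒜'_p(G)`. -/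
abbrev Quillen.ι (p : ℕ) (G : Type u) [Group G] : Quillen p G ⥤ QuillenCat p G :=
  (nontrivialElemAb p G).ι

/-- The collection of the sections `(C_G(E), E)`, where `E` is a nontrivial elementary abelian
`p`-subgroup of `G`. -/
def centCollection (p : ℕ) (G : Type u) [Group G] : ObjectProperty (Sec G) :=
  fun S => ∃ A : QuillenCat p G, A.E ≠ ⊥ ∧ S = A.centSec

/-- The full subcategory `𝒟ᶜ_G` of `𝒟_G` over the sections `(C_G(E), E)`, where `E` is a nontrivial
elementary abelian `p`-subgroup of `G`. -/
abbrev DCent (p : ℕ) (G : Type u) [Group G] : Type u := (centCollection p G).FullSubcategory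

/-- The functor `𝒜_p(G) ⥤ (𝒟ᶜ_G)ᵒᵖ`, `E ↦ (C_G(E), E)`. -/
def quillenToDCent (p : ℕ) (G : Type u) [Group G] : Quillen p G ⥤ (DCent p G)ᵒᵖ where
  obj A := op ⟨A.obj.centSec, A.obj, A.property, rfl⟩
  map f := (ObjectProperty.homMk ((QuillenCat.toSec p G).map f.hom).unop).op
  map_id A := by
    apply Quiver.Hom.unop_inj
    ext1
    exact congrArg Quiver.Hom.unop ((QuillenCat.toSec p G).map_id A.obj)
  map_comp f g := by
    apply Quiver.Hom.unop_inj
    ext1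
    exact congrArg Quiver.Hom.unop ((QuillenCat.toSec p G).map_comp f.hom g.hom)

/-! ### Modules over small categories -/

/- A functor category `C ⥤ ModuleCat R` has enough projectives: the free functors on the
representable ones are projective, and every functor is a quotient of a sum of these. -/

theorem projective_free_coyoneda {C : Type u} [SmallCategory C] (R : Type u) [Ring R] (c : Cᵒᵖ) :
    Projective (coyoneda.obj c ⋙ ModuleCat.free R) := by
  let adj := (ModuleCat.adj.{u} R).whiskerRight C
  refine ⟨fun {E X} f e he => ?_⟩
  have he' : Function.Surjective (e.app c.unop) :=
    (ModuleCat.epi_iff_surjective _).1 inferInstance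
  obtain ⟨y, hy⟩ := he' (coyonedaEquiv (F := X ⋙ forget _) (adj.homEquiv (coyoneda.obj c) X f))
  refine ⟨(adj.homEquiv (coyoneda.obj c) E).symm ((coyonedaEquiv (F := E ⋙ forget _)).symm y), ?_⟩
  apply (adj.homEquiv _ _).injective
  rw [Adjunction.homEquiv_naturality_right, Equiv.apply_symm_apply]
  apply coyonedaEquiv.injective
  refine Eq.trans ?_ hy
  rw [coyonedaEquiv_comp, Equiv.apply_symm_apply]
  rfl

instance enoughProjectives_functor (C : Type u) [SmallCategory C] (R : Type u) [Ring R] :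
    EnoughProjectives (C ⥤ ModuleCat.{u} R) where
  presentation F := by
    let adj := (ModuleCat.adj.{u} R).whiskerRight C
    let g : (Σ c : C, F.obj c) → (C ⥤ ModuleCat.{u} R) := fun i =>
      coyoneda.obj (op i.1) ⋙ ModuleCat.free R
    let φ : ∀ i, g i ⟶ F := fun i => (adj.homEquiv (coyoneda.obj (op i.1)) F).symm
      ((coyonedaEquiv (F := F ⋙ forget _)).symm i.2)
    have hg : ∀ i, Projective (g i) := fun i => projective_free_coyoneda R _
    suffices hφ : Epi (Limits.Sigma.desc φ) from ⟨{ p := ∐ g, f := Limits.Sigma.desc φ }⟩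
    rw [NatTrans.epi_iff_epi_app]
    intro c
    rw [ModuleCat.epi_iff_surjective]
    intro x
    have h1 : (adj.homEquiv (coyoneda.obj (op c)) F) (Limits.Sigma.ι g ⟨c, x⟩ ≫ Limits.Sigma.desc φ) =
        (coyonedaEquiv (F := F ⋙ forget _)).symm x := by
      rw [Limits.Sigma.ι_desc]
      exact Equiv.apply_symm_apply _ _
    rw [Adjunction.homEquiv_naturality_right] at h1
    have h2 := congrArg (coyonedaEquiv (F := F ⋙ forget _)) h1
    rw [coyonedaEquiv_comp, Equiv.apply_symm_apply] at h2
    exact ⟨_, h2⟩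

/-! ### Reduced cohomology -/

variable {G : Type u} [Group G] {R : Type u} [CommRing R]

/-- An `R𝒟_G`-module: a contravariant functor from `𝒟_G` to `R`-modules. -/
abbrev SecModule (R : Type u) [CommRing R] (G : Type u) [Group G] := (Sec G)ᵒᵖ ⥤ ModuleCat.{u} R

/-- The constant functor with value `R`. -/
abbrev constR (R : Type u) [CommRing R] (C : Type u) [SmallCategory C] : C ⥤ ModuleCat.{u} R :=
  (Functor.const C).obj (ModuleCat.of R R)

/-- The destriction map `F((M, L)) ⟶ F((U, V))` for `(U, V) ≼ (M, L)`. -/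
def des (F : SecModule R G) {S T : Sec G} (h : S ≤ T) : F.obj (op T) ⟶ F.obj (op S) :=
  F.map (incl h).op

namespace DStar

/-- The restriction of an `R𝒟_G`-module to `𝒟*_G`. -/
abbrev res (F : SecModule R G) : (DStar G)ᵒᵖ ⥤ ModuleCat.{u} R := (DStar.ι G).op ⋙ F

/-- The family of destriction maps from `(G, 1)` as a cone. -/
def cone (F : SecModule R G) : Cone (res F) where
  pt := F.obj (op (whole G))
  π :=
    { app := fun S => des F (le_whole S.unop.obj)
      naturality := fun S T f => by
        have e : incl (le_whole T.unop.obj) = f.unop.hom ≫ incl (le_whole S.unop.obj) := by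
          obtain ⟨g, hg⟩ := Quotient.exists_rep f.unop.hom
          rw [← hg]
          exact coset_eq _ _ (m := (g : G)) (Subgroup.mem_top _) (by simp)
        dsimp [des]
        rw [e, op_comp, F.map_comp]
        simp }

/-- The detection map `r : F(G) ⟶ lim_{(U, V) ∈ 𝒟*_G} F(U / V)`. -/
def detect (F : SecModule R G) : F.obj (op (whole G)) ⟶ limit (res F) := limit.lift _ (cone F)

/-- The reduced cohomology `H̃ⁿ(𝒟*_G; F)`: the kernel of `r` in degree `-1`, the cokernel of `r` in
degree `0`, and `Extⁿ(R, F)` over `R𝒟*_G` in degrees `n ≥ 1`. -/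
def reducedCohomology (F : SecModule R G) : ℤ → ModuleCat.{u} R
  | Int.negSucc 0 => kernel (detect F)
  | Int.negSucc (_ + 1) => ModuleCat.of R PUnit
  | Int.ofNat 0 => cokernel (detect F)
  | Int.ofNat (n + 1) =>
      ((Ext R ((DStar G)ᵒᵖ ⥤ ModuleCat.{u} R) (n + 1)).obj (op (constR R (DStar G)ᵒᵖ))).obj (res F)

end DStar

namespace Quillen

variable {p : ℕ}

/-- A projective resolution `P` of the constant functor for `𝒜_p(G)`. -/
def resolution (R : Type u) [CommRing R] (p : ℕ) (G : Type u) [Group G] :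
    ProjectiveResolution (constR R (Quillen p G)) := ProjectiveResolution.of _

/-- The augmentation `P₀ ⟶ R` of the resolution. -/
def resolutionε (R : Type u) [CommRing R] (p : ℕ) (G : Type u) [Group G] :
    (resolution R p G).complex.X 0 ⟶ constR R (Quillen p G) := (resolution R p G).π.f 0

theorem d_comp_resolutionε : (resolution R p G).complex.d 1 0 ≫ resolutionε R p G = 0 :=
  (resolution R p G).complex_d_comp_π_f_zero

/-- The map `Hom(R, M) ⟶ Hom(P₀, M)` induced by the augmentation of the resolution. -/
def augmentation (M : QuillenCat p G ⥤ ModuleCat.{u} R) :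
    ModuleCat.of R (constR R (QuillenCat p G) ⟶ M) ⟶
      ModuleCat.of R ((resolution R p G).complex.X 0 ⟶ Quillen.ι p G ⋙ M) :=
  ModuleCat.ofHom
    { toFun := fun f => resolutionε R p G ≫ Functor.whiskerLeft (Quillen.ι p G) f
      map_add' := fun _ _ => by ext; rfl
      map_smul' := fun _ _ => by ext; rfl }

/-- The cochain complex `0 ⟶ Hom(R, M) ⟶ Hom(P₀, M) ⟶ Hom(P₁, M) ⟶ ⋯` of a covariant
`R𝒜'_p(G)`-module `M`, where `R` is the constant functor for `𝒜'_p(G)` and the `Pᵢ`, extended by zero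
to the trivial subgroup, are regarded as `R𝒜'_p(G)`-modules; the homomorphisms from the extension
by zero to `M` are those from `Pᵢ` to the restriction of `M` to `𝒜_p(G)`. The term `Hom(R, M)` stands
in position `0`, which is cohomological degree `-1`. -/
def augmentedComplex (M : QuillenCat p G ⥤ ModuleCat.{u} R) : CochainComplex (ModuleCat.{u} R) ℕ :=
  ((resolution R p G).complex.linearYonedaObj R (Quillen.ι p G ⋙ M)).augment (augmentation M) (by
    ext f
    change (resolution R p G).complex.d 1 0 ≫ resolutionε R p G ≫
      Functor.whiskerLeft (Quillen.ι p G) f = 0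
    rw [← Category.assoc, d_comp_resolutionε, zero_comp])

/-- The reduced cohomology `H̃ⁿ(𝒜_p(G); M)`. -/
def reducedCohomology (M : QuillenCat p G ⥤ ModuleCat.{u} R) : ℤ → ModuleCat.{u} R
  | Int.negSucc 0 => (augmentedComplex M).homology 0
  | Int.negSucc (_ + 1) => ModuleCat.of R PUnit
  | Int.ofNat n => (augmentedComplex M).homology (n + 1)

end Quillen

/-- The `R𝒜'_p(G)`-module `F̄`, `F̄(E) = F(C_G(E) / E)`. -/
abbrev bar (p : ℕ) (F : SecModule R G) : QuillenCat p G ⥤ ModuleCat.{u} R :=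
  QuillenCat.toSec p G ⋙ F

/-! ### The gluing problem -/

/-- The section `(N_G(H), H)`. -/
def normSec (H : Subgroup G) : Sec G :=
  Sec.of (Subgroup.normalizer H) H Subgroup.le_normalizer
    fun _ hu v hv => (Subgroup.mem_normalizer_iff.1 hu v).1 hv

/-- The section `(N_G(H, K), H)` for `K ⊴ H`, where `N_G(H, K) = N_G(H) ∩ N_G(K)`. -/
def normSec₂ (H K : Subgroup G) (h : H ≤ Subgroup.normalizer K) : Sec G :=
  Sec.of (Subgroup.normalizer H ⊓ Subgroup.normalizer K) H (le_inf Subgroup.le_normalizer h)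
    fun _ hu v hv => (Subgroup.mem_normalizer_iff.1 hu.1 v).1 hv

/-- The conjugate `g H g⁻¹` of a nontrivial subgroup. -/
def conjSub (g : G) (H : {H : Subgroup G // H ≠ ⊥}) : {H : Subgroup G // H ≠ ⊥} :=
  ⟨MulAut.conj g • H.1, fun h => H.2 (by
    rw [← inv_smul_smul (MulAut.conj g) H.1, h, Subgroup.smul_bot])⟩

theorem smul_normSec (g : G) (H : Subgroup G) : g • normSec H = normSec (MulAut.conj g • H) := by
  refine Sec.ext (Subgroup.ext fun x => ?_) rfl
  rw [mem_smul_U]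
  change g⁻¹ * x * g ∈ Subgroup.normalizer (H : Set G) ↔
    x ∈ Subgroup.normalizer ((MulAut.conj g • H : Subgroup G) : Set G)
  simp only [Subgroup.mem_normalizer_iff, mem_smul_subgroup]
  constructor
  · intro h y
    simpa [mul_assoc] using h (g⁻¹ * y * g)
  · intro h y
    simpa [mul_assoc] using h (g * y * g⁻¹)

theorem map_homOf_comp (F : SecModule R G) {S T W : Sec G} {g h k : G} (hg : g • S ≤ T)
    (hh : h • T ≤ W) (hk : k • S ≤ W) {m : G} (hm : m ∈ W.U) (e : k = m * (h * g))
    (x : F.obj (op W)) :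
    F.map (homOf g hg).op (F.map (homOf h hh).op x) = F.map (homOf k hk).op x := by
  rw [← ConcreteCategory.comp_apply, ← F.map_comp, ← op_comp, homOf_comp]
  have : homOf (h * g) (mul_smul_le hg hh) = homOf k hk := coset_eq _ _ hm e
  rw [this]

/-- The conjugation map `F(S) ⟶ F(g • S)`. -/
def conjMap (F : SecModule R G) (g : G) {S T : Sec G} (h : g • S = T) :
    F.obj (op S) ⟶ F.obj (op T) :=
  F.map (homOf g⁻¹ (by rw [← h, inv_smul_smul]; exact le_refl' S)).op

/-- The module of gluing data for `F(G)`: the sequences of elements `f_H ∈ F(N_G(H) / H)`,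
`1 < H ≤ G`, that are invariant under conjugation and under destriction. -/
def gluingData (F : SecModule R G) :
    Submodule R (∀ H : {H : Subgroup G // H ≠ ⊥}, F.obj (op (normSec H.1))) where
  carrier := {f |
    (∀ (g : G) (H : {H : Subgroup G // H ≠ ⊥}),
      conjMap F g (smul_normSec g H.1) (f H) = f (conjSub g H)) ∧
    (∀ (K H : {H : Subgroup G // H ≠ ⊥}) (hKH : K.1 ≤ H.1) (h : H.1 ≤ Subgroup.normalizer K.1),
      des F (show normSec₂ H.1 K.1 h ≤ normSec K.1 from ⟨hKH, inf_le_right⟩) (f K) =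
        des F (show normSec₂ H.1 K.1 h ≤ normSec H.1 from ⟨le_rfl, inf_le_left⟩) (f H))}
  zero_mem' := ⟨fun _ _ => map_zero _, fun _ _ _ _ => (map_zero _).trans (map_zero _).symm⟩
  add_mem' := fun ha hb =>
    ⟨fun g H => (map_add _ _ _).trans (congrArg₂ _ (ha.1 g H) (hb.1 g H)), fun K H h h' =>
      (map_add _ _ _).trans ((congrArg₂ _ (ha.2 K H h h') (hb.2 K H h h')).trans
        (map_add _ _ _).symm)⟩
  smul_mem' := fun _ _ ha =>
    ⟨fun g H => (map_smul _ _ _).trans (congrArg _ (ha.1 g H)), fun K H h h' =>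
      (map_smul _ _ _).trans ((congrArg _ (ha.2 K H h h')).trans (map_smul _ _ _).symm)⟩

/-- The map `r` from `F(G)` to the gluing data, `f ↦ (Defres_{N_G(H) / H} f)_H`. -/
def gluingMap (F : SecModule R G) : F.obj (op (whole G)) →ₗ[R] gluingData F where
  toFun f := ⟨fun H => des F (le_whole _) f,
    fun g H => map_homOf_comp F _ _ _ (m := g) (Subgroup.mem_top _) (by simp) f,
    fun K H h h' =>
      (map_homOf_comp F _ _ _ (one_mem _) (by simp) f).trans
        (map_homOf_comp F _ _ (k := 1) (by rw [one_smul]; exact le_whole _) (one_mem _)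
          (by simp) f).symm⟩
  map_add' := fun _ _ => Subtype.ext (funext fun _ => map_add _ _ _)
  map_smul' := fun _ _ => Subtype.ext (funext fun _ => map_smul _ _ _)

/-- The obstruction group `Obs(F(G))`: the cokernel of the map from `F(G)` to the gluing data. -/
def obstructionGroup (F : SecModule R G) : ModuleCat.{u} R :=
  ModuleCat.of R (gluingData F ⧸ LinearMap.range (gluingMap F))

/-! ### Biset functors -/

/-- A finite `(K, H)`-biset: a finite set with commuting actions of `K` from the left and of `H` from
the right. -/
structure Biset (K H : Type u) [Group K] [Group H] where
  carrier : Type u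
  [finite : Finite carrier]
  [left : MulAction K carrier]
  [right : MulAction Hᵐᵒᵖ carrier]
  [comm : SMulCommClass K Hᵐᵒᵖ carrier]

namespace Biset

attribute [instance] finite left right comm

variable {K H L : Type u} [Group K] [Group H] [Group L]

/-- Two bisets are isomorphic. -/
def IsIso (X Y : Biset K H) : Prop :=
  ∃ e : X.carrier ≃ Y.carrier, (∀ (k : K) x, e (k • x) = k • e x) ∧
    ∀ (h : Hᵐᵒᵖ) x, e (h • x) = h • e x

/-- The disjoint union of two bisets. -/
def sum (X Y : Biset K H) : Biset K H where
  carrier := X.carrier ⊕ Y.carrier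
  comm := ⟨by rintro k h (x | x) <;> simp [smul_comm]⟩

/-- The identity biset `H`. -/
def refl (H : Type u) [Group H] [Finite H] : Biset H H where
  carrier := H

/-- The orbit relation of the action `h · (x, y) = (x h⁻¹, h y)` of `H` on `X × Y`. -/
def prodSetoid (X : Biset K H) (Y : Biset H L) : Setoid (X.carrier × Y.carrier) where
  r a b := ∃ h : H, b = (MulOpposite.op h⁻¹ • a.1, h • a.2)
  iseqv :=
    ⟨fun a => ⟨1, by simp⟩,
     fun {a b} ⟨h, e⟩ => ⟨h⁻¹, by simp [e]⟩,
     fun {a b c} ⟨h, e⟩ ⟨h', e'⟩ => ⟨h' * h, by simp [e, e', mul_smul]⟩⟩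

instance prodLeft (X : Biset K H) (Y : Biset H L) : MulAction K (Quotient (prodSetoid X Y)) where
  smul k := Quotient.map (fun a => (k • a.1, a.2)) (by
    rintro a b ⟨h, rfl⟩
    exact ⟨h, by simp [smul_comm]⟩)
  one_smul := by
    rintro ⟨a⟩
    exact congrArg (Quotient.mk _) (by simp)
  mul_smul := by
    rintro k k' ⟨a⟩
    exact congrArg (Quotient.mk _) (by simp [mul_smul])

instance prodRight (X : Biset K H) (Y : Biset H L) :
    MulAction Lᵐᵒᵖ (Quotient (prodSetoid X Y)) where
  smul l := Quotient.map (fun a => (a.1, l • a.2)) (by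
    rintro a b ⟨h, rfl⟩
    exact ⟨h, by simp [smul_comm]⟩)
  one_smul := by
    rintro ⟨a⟩
    exact congrArg (Quotient.mk _) (by simp)
  mul_smul := by
    rintro k k' ⟨a⟩
    exact congrArg (Quotient.mk _) (by simp [mul_smul])

/-- The composition product `X ×_H Y` of bisets. -/
def prod (X : Biset K H) (Y : Biset H L) : Biset K L where
  carrier := Quotient (prodSetoid X Y)
  comm := ⟨by
    rintro k l ⟨a⟩
    rfl⟩

end Biset

/-- A biset functor for `G` over `R`: an `R`-linear functor to `R`-modules on the `R`-biset category
over the subquotients `U / V` of `G`, indexed by the sections `(U, V)` of `G`. The `R`-module of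
morphisms from `M / L` to `U / V` is `R ⊗ B(U / V, M / L)`, where `B(U / V, M / L)` is the
Grothendieck group of the isomorphism classes of finite `(U / V, M / L)`-bisets under disjoint
union; an `R`-linear map from it to an `R`-module is therefore a function of bisets that is invariant
under isomorphism and takes disjoint unions to sums. Composition is the composition product. -/
structure BisetFunctor (R : Type u) [CommRing R] (G : Type u) [Group G] [Finite G] where
  obj : Sec G → ModuleCat.{u} R
  map {S T : Sec G} : Biset S.Quot T.Quot → (obj T ⟶ obj S)
  map_iso {S T : Sec G} {X Y : Biset S.Quot T.Quot} : X.IsIso Y → map X = map Y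
  map_sum {S T : Sec G} (X Y : Biset S.Quot T.Quot) : map (X.sum Y) = map X + map Y
  map_refl (S : Sec G) : map (Biset.refl S.Quot) = 𝟙 (obj S)
  map_prod {S T W : Sec G} (X : Biset S.Quot T.Quot) (Y : Biset T.Quot W.Quot) :
    map (X.prod Y) = map Y ≫ map X

/-- The orbits of `V` on the set `g⁻¹ M = {x | g x ∈ M}`. -/
def desSetoid (S T : Sec G) (g : G) : Setoid {x : G // g * x ∈ T.U} where
  r x y := ∃ v ∈ S.V, (y : G) = v * x
  iseqv :=
    ⟨fun x => ⟨1, one_mem _, by simp⟩,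
     fun {x y} ⟨v, hv, e⟩ => ⟨v⁻¹, inv_mem hv, by simp [e]⟩,
     fun {x y z} ⟨v, hv, e⟩ ⟨w, hw, e'⟩ => ⟨w * v, mul_mem hw hv, by simp [e, e', mul_assoc]⟩⟩

theorem des_left_mem {S T : Sec G} {g u x : G} (h : g • S ≤ T) (hu : u ∈ S.U) (hx : g * x ∈ T.U) :
    g * (u * x) ∈ T.U := by
  have h1 : g * u * g⁻¹ ∈ T.U := h.2 (mem_smul_U.2 (by simpa [mul_assoc] using hu))
  simpa [mul_assoc] using mul_mem h1 hx

theorem des_right_mem {S T : Sec G} {g l x : G} (h : g • S ≤ T) (hl : l ∈ T.V) (hx : g * x ∈ T.U) :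
    x * l * x⁻¹ ∈ S.V := by
  have h1 := T.conj_mem hx hl
  have h2 := mem_smul_V.1 (h.1 h1)
  simpa [mul_assoc] using h2

/-- The left action of `U / V` on `V \ g⁻¹ M` by multiplication. -/
abbrev desLeft {S T : Sec G} (g : G) (h : g • S ≤ T) : MulAction S.Quot (Quotient (desSetoid S T g)) where
  smul := Quotient.map₂ (fun u x => ⟨u * x, des_left_mem h u.2 x.2⟩) (by
    rintro ⟨u, hu⟩ ⟨u', hu'⟩ e ⟨x, hx⟩ ⟨x', hx'⟩ ⟨v, hv, e'⟩
    have e1 : (⟨u, hu⟩ : S.U)⁻¹ * ⟨u', hu'⟩ ∈ S.V.subgroupOf S.U := QuotientGroup.leftRel_apply.1 e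
    have e1' : u⁻¹ * u' ∈ S.V := e1
    dsimp only at e'
    have e2 := S.conj_mem hu (mul_mem e1' hv)
    exact ⟨_, e2, by simp [e', mul_assoc]⟩)
  one_smul := by
    rintro ⟨x⟩
    exact congrArg (Quotient.mk _) (Subtype.ext (one_mul _))
  mul_smul := by
    rintro ⟨u⟩ ⟨u'⟩ ⟨x⟩
    exact congrArg (Quotient.mk _) (Subtype.ext (mul_assoc _ _ _))

/-- The right action of `M / L` on `V \ g⁻¹ M` by multiplication. -/
abbrev desRight {S T : Sec G} (g : G) (h : g • S ≤ T) :
    MulAction T.Quotᵐᵒᵖ (Quotient (desSetoid S T g)) where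
  smul m := Quotient.map₂ (fun (m : T.U) x => ⟨x * m, by
      rw [← mul_assoc]
      exact mul_mem x.2 m.2⟩) (by
    rintro ⟨m, hm⟩ ⟨m', hm'⟩ e ⟨x, hx⟩ ⟨x', hx'⟩ ⟨v, hv, e'⟩
    have e1 : (⟨m, hm⟩ : T.U)⁻¹ * ⟨m', hm'⟩ ∈ T.V.subgroupOf T.U := QuotientGroup.leftRel_apply.1 e
    have e1' : m⁻¹ * m' ∈ T.V := e1
    dsimp only at e'
    have e2 := des_right_mem h (T.conj_mem hm e1') hx
    exact ⟨_, mul_mem hv e2, by simp [e', mul_assoc]⟩) m.unop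
  one_smul := by
    rintro ⟨x⟩
    exact congrArg (Quotient.mk _) (Subtype.ext (mul_one _))
  mul_smul := by
    rintro ⟨⟨m⟩⟩ ⟨⟨m'⟩⟩ ⟨x⟩
    exact congrArg (Quotient.mk _) (Subtype.ext (mul_assoc _ _ _).symm)

/-- For `g • (U, V) ≼ (M, L)`, the `(U / V, M / L)`-biset `V \ g⁻¹ M` with the actions by
multiplication. It is the composition of the destriction biset from `M / L` to `gUg⁻¹ / gVg⁻¹` and of
the isogation of the conjugation by `g⁻¹`. -/
def desBiset [Finite G] {S T : Sec G} (g : G) (h : g • S ≤ T) : Biset S.Quot T.Quot :=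
  letI := desLeft g h
  letI := desRight g h
  { carrier := Quotient (desSetoid S T g)
    comm := ⟨by
      rintro ⟨u⟩ ⟨⟨m⟩⟩ ⟨x⟩
      exact congrArg (Quotient.mk _) (Subtype.ext (mul_assoc _ _ _).symm)⟩ }

theorem desBiset_eq [Finite G] {S T : Sec G} {g g' : G} (h : g • S ≤ T) (h' : g' • S ≤ T) {m : G}
    (hm : m ∈ T.U) (e : g' = m * g) : (desBiset g h).IsIso (desBiset g' h') := by
  have key : ∀ x, g * x ∈ T.U ↔ g' * x ∈ T.U := fun x => by
    rw [e, mul_assoc, Subgroup.mul_mem_cancel_left _ hm]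
  refine ⟨Quotient.congr (Equiv.subtypeEquivRight key) fun a b => Iff.rfl, ?_, ?_⟩
  · rintro ⟨u⟩ ⟨x⟩
    rfl
  · rintro ⟨⟨u⟩⟩ ⟨x⟩
    rfl

theorem desBiset_one [Finite G] (S : Sec G) (h : (1 : G) • S ≤ S) :
    (desBiset 1 h).IsIso (Biset.refl S.Quot) := by
  have f1 : ∀ x : {x : G // 1 * x ∈ S.U}, (x : G) ∈ S.U := fun x => by simpa using x.2
  let f : (desBiset 1 h).carrier → S.Quot := Quotient.map (fun x => ⟨x, f1 x⟩) (by
    rintro ⟨x, hx⟩ ⟨y, hy⟩ ⟨v, hv, e⟩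
    refine QuotientGroup.leftRel_apply.2 (?_ : x⁻¹ * y ∈ S.V)
    dsimp only at e
    rw [one_mul] at hx
    have := S.conj_mem (inv_mem hx) hv
    simpa [e, mul_assoc] using this)
  have hf : Function.Bijective f := by
    constructor
    · rintro ⟨x, hx⟩ ⟨y, hy⟩ e
      have e0 := QuotientGroup.leftRel_apply.1 (Quotient.exact (e : Quotient.mk _ _ = Quotient.mk _ _))
      have e1 : x⁻¹ * y ∈ S.V := e0
      rw [one_mul] at hx
      exact Quotient.sound ⟨_, S.conj_mem hx e1, by simp⟩
    · rintro ⟨u, hu⟩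
      exact ⟨Quotient.mk _ ⟨u, by simpa using hu⟩, rfl⟩
  refine ⟨Equiv.ofBijective f hf, ?_, ?_⟩
  · rintro ⟨u⟩ ⟨x⟩
    rfl
  · rintro ⟨⟨u⟩⟩ ⟨x⟩
    rfl

theorem desBiset_comp [Finite G] {S T W : Sec G} {g h : G} (hg : g • S ≤ T) (hh : h • T ≤ W) :
    (desBiset (h * g) (mul_smul_le hg hh)).IsIso ((desBiset g hg).prod (desBiset h hh)) := by
  have f1 : ∀ x : {x : G // h * g * x ∈ W.U}, h * (g * x) ∈ W.U := fun x => by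
    simpa [mul_assoc] using x.2
  let f : (desBiset (h * g) (mul_smul_le hg hh)).carrier →
      ((desBiset g hg).prod (desBiset h hh)).carrier :=
    Quotient.map (fun x => (Quotient.mk _ ⟨g⁻¹, by simp⟩, Quotient.mk _ ⟨g * x, f1 x⟩)) (by
      rintro ⟨x, hx⟩ ⟨y, hy⟩ ⟨v, hv, e⟩
      dsimp only at e
      have hv' : g * v * g⁻¹ ∈ T.U :=
        hg.2 (mem_smul_U.2 (by simpa [mul_assoc] using S.le hv))
      refine ⟨QuotientGroup.mk ⟨g * v * g⁻¹, hv'⟩, Prod.ext ?_ ?_⟩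
      · exact Quotient.sound ⟨v⁻¹, inv_mem hv, by simp [mul_assoc]⟩
      · exact congrArg (Quotient.mk _) (Subtype.ext (by simp [e, mul_assoc])))
  have hf : Function.Bijective f := by
    constructor
    · rintro ⟨x, hx⟩ ⟨y, hy⟩ e
      obtain ⟨⟨m, hm⟩, e1⟩ := Quotient.exact e
      have e2 := congrArg Prod.fst e1
      have e3 := congrArg Prod.snd e1
      obtain ⟨v, hv, e4⟩ := Quotient.exact e2
      obtain ⟨l, hl, e5⟩ := Quotient.exact e3
      change g⁻¹ * m⁻¹ = v * g⁻¹ at e4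
      change m * (g * x) = l * (g * y) at e5
      have hl' : g⁻¹ * l * g ∈ S.V := mem_smul_V.1 (hg.1 hl)
      refine Quotient.sound ⟨(g⁻¹ * l * g)⁻¹ * v⁻¹, mul_mem (inv_mem hl') (inv_mem hv), ?_⟩
      change y = (g⁻¹ * l * g)⁻¹ * v⁻¹ * x
      have e6 : m = g * v⁻¹ * g⁻¹ := by
        rw [← inv_inj, ← mul_right_inj g⁻¹, e4]
        group
      have e7 : y = g⁻¹ * l⁻¹ * (l * (g * y)) := by group
      rw [e7, ← e5, e6]
      group
    · rintro ⟨⟨⟨x, hx⟩, ⟨y, hy⟩⟩⟩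
      have hxy : h * g * (x * y) ∈ W.U := by
        have h1 : h * (g * x) * h⁻¹ ∈ W.U := hh.2 (mem_smul_U.2 (by simpa [mul_assoc] using hx))
        simpa [mul_assoc] using mul_mem h1 hy
      refine ⟨Quotient.mk _ ⟨x * y, hxy⟩, Quotient.sound
        ⟨QuotientGroup.mk ⟨(g * x)⁻¹, inv_mem hx⟩, Prod.ext ?_ ?_⟩⟩
      · exact congrArg (Quotient.mk _) (Subtype.ext (by simp))
      · exact congrArg (Quotient.mk _) (Subtype.ext (by simp [mul_assoc]))
  refine ⟨Equiv.ofBijective f hf, ?_, ?_⟩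
  · rintro ⟨⟨u, hu⟩⟩ ⟨⟨x, hx⟩⟩
    have hu' : g * u⁻¹ * g⁻¹ ∈ T.U :=
      hg.2 (mem_smul_U.2 (by simpa [mul_assoc] using inv_mem hu))
    refine Quotient.sound ⟨QuotientGroup.mk ⟨g * u⁻¹ * g⁻¹, hu'⟩, Prod.ext ?_ ?_⟩
    · exact congrArg (Quotient.mk _) (Subtype.ext (by simp [mul_assoc]))
    · exact congrArg (Quotient.mk _) (Subtype.ext (by simp [mul_assoc]))
  · rintro ⟨⟨n, hn⟩⟩ ⟨⟨x, hx⟩⟩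
    refine congrArg (Quotient.mk _) (Prod.ext rfl ?_)
    exact congrArg (Quotient.mk _) (Subtype.ext (mul_assoc _ _ _).symm)

/-- The action of a coset `M g : (U, V) ⟶ (M, L)` on a biset functor, by the
`(U / V, M / L)`-biset that is the destriction followed by the conjugation by `g⁻¹`. -/
def BisetFunctor.mapCoset [Finite G] (B : BisetFunctor R G) {S T : Sec G} :
    Sec.Hom S T → (B.obj T ⟶ B.obj S) :=
  Quotient.lift (fun g => B.map (desBiset g.1 g.2)) (by
    rintro ⟨g, hg⟩ ⟨g', hg'⟩ ⟨m, hm, e⟩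
    exact B.map_iso (desBiset_eq hg hg' hm e))

/-- The `R𝒟_G`-module of a biset functor. -/
def BisetFunctor.toSecModule [Finite G] (B : BisetFunctor R G) : SecModule R G where
  obj S := B.obj S.unop
  map f := B.mapCoset f.unop
  map_id S := (B.map_iso (desBiset_one S.unop (by rw [one_smul]; exact le_refl' _))).trans
    (B.map_refl _)
  map_comp := by
    rintro ⟨W⟩ ⟨T⟩ ⟨S⟩ ⟨f⟩ ⟨f'⟩
    obtain ⟨⟨h, hh⟩, rfl⟩ := Quotient.exists_rep f
    obtain ⟨⟨g, hg⟩, rfl⟩ := Quotient.exists_rep f'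
    exact (B.map_iso (desBiset_comp hg hh)).trans (B.map_prod _ _)

/-! ### Destriction functors -/

/-- The generators of the destriction algebra: `conj g K` is the conjugation `c^g` from `K` to
`g • K`, and `des H K h` is the destriction from `H` to `K`, where `K ≼ H`. -/
inductive DesGen (G : Type u) [Group G] : Type u
  | conj (g : G) (K : Sec G) : DesGen G
  | des (H K : Sec G) (h : K ≤ H) : DesGen G

/-- The section on which a generator is defined. -/
def DesGen.source : DesGen G → Sec G
  | conj _ K => K
  | des H _ _ => H

/-- The section in which a generator takes its values. -/
def DesGen.target : DesGen G → Sec G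
  | conj g K => g • K
  | des _ K _ => K

instance [Finite G] : Fintype (Sec G) := Fintype.ofFinite _

/-- The relations of the destriction algebra. -/
inductive DesRel (R : Type u) [CommRing R] (G : Type u) [Group G] [Finite G] :
    FreeAlgebra R (DesGen G) → FreeAlgebra R (DesGen G) → Prop
  | inner (H : Sec G) (h : G) (hh : h ∈ H.U) :
      DesRel R G (FreeAlgebra.ι R (.conj h H)) (FreeAlgebra.ι R (.des H H (le_refl' H)))
  | conj_conj (g g' : G) (H : Sec G) :
      DesRel R G (FreeAlgebra.ι R (.conj g (g' • H)) * FreeAlgebra.ι R (.conj g' H))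
        (FreeAlgebra.ι R (.conj (g * g') H))
  | des_des (H K L : Sec G) (h : K ≤ H) (h' : L ≤ K) :
      DesRel R G (FreeAlgebra.ι R (.des K L h') * FreeAlgebra.ι R (.des H K h))
        (FreeAlgebra.ι R (.des H L (le_trans' h' h)))
  | des_conj (g : G) (H K : Sec G) (h : K ≤ H) :
      DesRel R G
        (FreeAlgebra.ι R (.des (g • H) (g • K) (smul_le_smul g h)) * FreeAlgebra.ι R (.conj g H))
        (FreeAlgebra.ι R (.conj g K) * FreeAlgebra.ι R (.des H K h))
  | one : DesRel R G 1 (∑ S : Sec G, FreeAlgebra.ι R (.conj 1 S))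
  | zero (a b : DesGen G) (h : a.source ≠ b.target) :
      DesRel R G (FreeAlgebra.ι R a * FreeAlgebra.ι R b) 0

/-- The destriction algebra `∇_G(R)`. -/
abbrev DesAlgebra (R : Type u) [CommRing R] (G : Type u) [Group G] [Finite G] : Type u :=
  RingQuot (DesRel R G)

namespace DesAlgebra

variable [Finite G]

/-- The class of a generator in the destriction algebra. -/
def gen (R : Type u) [CommRing R] (a : DesGen G) : DesAlgebra R G :=
  RingQuot.mkAlgHom R (DesRel R G) (FreeAlgebra.ι R a)

theorem gen_conj_conj (g g' : G) (H : Sec G) :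
    gen R (.conj g (g' • H)) * gen R (.conj g' H) = gen R (.conj (g * g') H) := by
  simpa only [map_mul, gen] using RingQuot.mkAlgHom_rel R (DesRel.conj_conj (R := R) g g' H)

theorem gen_des_des {H K L : Sec G} (h : K ≤ H) (h' : L ≤ K) :
    gen R (.des K L h') * gen R (.des H K h) = gen R (.des H L (le_trans' h' h)) := by
  simpa only [map_mul, gen] using RingQuot.mkAlgHom_rel R (DesRel.des_des (R := R) H K L h h')

theorem gen_des_conj (g : G) {H K : Sec G} (h : K ≤ H) :
    gen R (.des (g • H) (g • K) (smul_le_smul g h)) * gen R (.conj g H) =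
      gen R (.conj g K) * gen R (.des H K h) := by
  simpa only [map_mul, gen] using RingQuot.mkAlgHom_rel R (DesRel.des_conj (R := R) g H K h)

theorem gen_inner {H : Sec G} {h : G} (hh : h ∈ H.U) :
    gen R (.conj h H) = gen R (.des H H (le_refl' H)) :=
  RingQuot.mkAlgHom_rel R (DesRel.inner (R := R) H h hh)

variable (M : Type u) [AddCommGroup M] [Module R M] [Module (DesAlgebra R G) M]
  [IsScalarTower R (DesAlgebra R G) M]

/-- The summand `c_{U/V} M`, that is, the fixed points of the idempotent `c_{U/V}`. -/
def component (R : Type u) [CommRing R] [Module R M] [Module (DesAlgebra R G) M]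
    [IsScalarTower R (DesAlgebra R G) M] (S : Sec G) : Submodule R M where
  carrier := {x | gen R (.conj 1 S) • x = x}
  zero_mem' := smul_zero _
  add_mem' := fun {a b} ha hb => by
    simp only [Set.mem_ofPred_eq] at ha hb ⊢
    rw [smul_add, ha, hb]
  smul_mem' := fun r a ha => by
    simp only [Set.mem_ofPred_eq] at ha ⊢
    rw [smul_algebra_smul_comm, ha]

/-- The element `c^{g⁻¹} Des` of the destriction algebra for `g • (U, V) ≼ (M, L)`. -/
def cDes (R : Type u) [CommRing R] {S T : Sec G} (g : G) (h : g • S ≤ T) : DesAlgebra R G :=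
  gen R (.conj g⁻¹ (g • S)) * gen R (.des T (g • S) h)

theorem cDes_mem {S T : Sec G} (g : G) (h : g • S ≤ T) (x : M) :
    cDes R g h • x ∈ component M R S := by
  change gen R (.conj 1 S) • cDes R g h • x = cDes R g h • x
  have := gen_conj_conj (R := R) 1 g⁻¹ (g • S)
  rw [inv_smul_smul, one_mul] at this
  rw [smul_smul, cDes, ← mul_assoc, this]

theorem cDes_comp {S T W : Sec G} {g h : G} (hg : g • S ≤ T) (hh : h • T ≤ W) :
    cDes R g hg * cDes R h hh = cDes R (h * g) (mul_smul_le hg hh) := by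
  have h1 := gen_des_conj (R := R) h⁻¹ (smul_le_smul h hg)
  have h2 := gen_conj_conj (R := R) g⁻¹ h⁻¹ (h • g • S)
  have h3 := gen_des_des (R := R) hh (smul_le_smul h hg)
  simp only [inv_smul_smul] at h1 h2
  simp only [cDes, mul_smul, mul_inv_rev]
  calc _ = gen R (.conj g⁻¹ (g • S)) * (gen R (.des T (g • S) hg) * gen R (.conj h⁻¹ (h • T))) *
        gen R (.des W (h • T) hh) := by simp only [mul_assoc]
    _ = gen R (.conj g⁻¹ (g • S)) * gen R (.conj h⁻¹ (h • g • S)) *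
        (gen R (.des (h • T) (h • g • S) (smul_le_smul h hg)) * gen R (.des W (h • T) hh)) := by
      rw [h1]
      simp only [mul_assoc]
    _ = _ := by rw [h2, h3]

theorem cDes_of_mem {T : Sec G} {m : G} (hm : m ∈ T.U) (h : m • T ≤ T) :
    cDes R m h = gen R (.conj 1 T) := by
  have h1 := gen_inner (R := R) (inv_mem hm)
  have h2 := gen_inner (R := R) (one_mem T.U)
  have h3 := gen_des_des (R := R) (le_refl' T) (le_refl' T)
  simp only [cDes, smul_eq_of_mem hm]
  rw [h1, h2, h3]

theorem cDes_eq {S T : Sec G} {g g' : G} (h : g • S ≤ T) (h' : g' • S ≤ T) {m : G}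
    (hm : m ∈ T.U) (e : g' = m * g) : cDes R g h = cDes R g' h' := by
  subst e
  have h0 : m • T ≤ T := by
    rw [smul_eq_of_mem hm]
    exact le_refl' T
  rw [← cDes_comp h h0, cDes_of_mem hm, gen_inner (one_mem T.U), cDes, mul_assoc, gen_des_des]

end DesAlgebra

open DesAlgebra

section

variable [Finite G] (M : Type u) [AddCommGroup M] [Module R M] [Module (DesAlgebra R G) M]
  [IsScalarTower R (DesAlgebra R G) M]

/-- The action of a coset `M g : (U, V) ⟶ (M, L)` on a module over the destriction algebra, by
`c^{g⁻¹} Des`. -/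
def destrictionMap (R : Type u) [CommRing R] [Module R M] [Module (DesAlgebra R G) M]
    [IsScalarTower R (DesAlgebra R G) M] {S T : Sec G} :
    Sec.Hom S T → (ModuleCat.of R (component M R T) ⟶ ModuleCat.of R (component M R S)) :=
  Quotient.lift (fun g => ModuleCat.ofHom
      (LinearMap.restrict (p := component M R T) (q := component M R S)
        (Algebra.lsmul R R M (cDes R g.1 g.2)) fun x _ => cDes_mem M g.1 g.2 x)) (by
    rintro ⟨g, hg⟩ ⟨g', hg'⟩ ⟨m, hm, e⟩
    refine ModuleCat.hom_ext (LinearMap.ext fun x => Subtype.ext ?_)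
    exact congrArg (fun a : DesAlgebra R G => a • (x : M)) (cDes_eq hg hg' hm e))

/-- The `R𝒟_G`-module of a destriction functor for `G` over `R`, that is, of a module over the
destriction algebra. -/
def destrictionModule (R : Type u) [CommRing R] [Module R M] [Module (DesAlgebra R G) M]
    [IsScalarTower R (DesAlgebra R G) M] : SecModule R G where
  obj S := ModuleCat.of R (component M R S.unop)
  map f := destrictionMap M R f.unop
  map_id S := by
    refine ModuleCat.hom_ext (LinearMap.ext fun x => Subtype.ext ?_)
    have h0 : (1 : G) • S.unop ≤ S.unop := by
      rw [one_smul]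
      exact le_refl' _
    exact (congrArg (fun a : DesAlgebra R G => a • (x : M)) (cDes_of_mem (one_mem _) h0)).trans x.2
  map_comp := by
    rintro ⟨W⟩ ⟨T⟩ ⟨S⟩ ⟨f⟩ ⟨f'⟩
    obtain ⟨⟨h, hh⟩, rfl⟩ := Quotient.exists_rep f
    obtain ⟨⟨g, hg⟩, rfl⟩ := Quotient.exists_rep f'
    refine ModuleCat.hom_ext (LinearMap.ext fun x => Subtype.ext ?_)
    exact (congrArg (fun a : DesAlgebra R G => a • (x : M)) (cDes_comp hg hh).symm).trans
      (mul_smul _ _ _)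

end

end

end SectionGluing

open SectionGluing

namespace SectionGluing

noncomputable section

/-! ### Categorical preliminaries -/

/-! The core is an adjunction. A coset `C_G(E) g : (U, V) ⟶ (C_G(E), E)` is an element `g`, up to
left multiplication by `C_G(E)`, such that `g⁻¹ E g ≤ V` and `U` centralizes `g⁻¹ E g`.
Equivalently, `g⁻¹ E g` lies in the socle of `(U, V)`, the group of the `x ∈ V` with `x ^ p = 1`
that commute with `U`. Two elements define the same coset of `C_G(E)` exactly when they conjugate
`E` in the same way, so these morphisms are the morphisms from `E` to the socle in the Quillen
category (`IsSocle.homEquiv`). For `V ≠ 1` the socle is nontrivial, because a nontrivial normal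
subgroup of a finite `p`-group meets the center. Hence `J : E ↦ (C_G(E), E)`, from `𝒜_p(G)` to
`(𝒟*_G)ᵒᵖ`, has the socle as right adjoint `T` (`quillenAdjunction`). The socle of `(C_G(E), E)` is
`E` itself, which gives the full faithfulness in the isomorphism with `(𝒟ᶜ_G)ᵒᵖ`.

Precomposition with `T` is then left adjoint to precomposition with `J`. It is exact, preserves
projectives and fixes the constant functor, so it carries a projective resolution `P` of the
constant functor of `𝒜_p(G)` to one over `(𝒟*_G)ᵒᵖ`, and `Hom(T^*P, F) = Hom(P, J^*F)`, where `J^*F`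
is the restriction of `F̄`. This settles the degrees `n ≥ 1` (`extWhiskerIso`).

In degrees `-1` and `0`, the trivial subgroup is initial in `𝒜'_p(G)`, so `Hom(R, F̄) = F(G)`. The
limit of `F` over `𝒟*_G` is `Hom(R, F)`, by adjunction the kernel of `Hom(P₀, F̄) ⟶ Hom(P₁, F̄)`.
Under these identifications the augmentation is the detection map followed by the inclusion of that
kernel (`wholeIso_comp_augmentation`).

For the obstruction group, every section satisfies `(U, V) ≼ (N_G(V), V)`. An element of the limit
is therefore determined by its values at the sections `(N_G(H), H)`, and the relations between these
values are those of a gluing data (`gluingIso`). -/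

/-- A fully faithful functor that is bijective on objects is an isomorphism of categories. -/
theorem exists_strict_inverse {C D : Type u} [SmallCategory C] [SmallCategory D] (F : C ⥤ D)
    [F.Full] [F.Faithful] (hF : Function.Bijective F.obj) :
    ∃ Ψ : D ⥤ C, F ⋙ Ψ = 𝟭 C ∧ Ψ ⋙ F = 𝟭 D := by
  obtain ⟨i, hl, hr⟩ := Function.bijective_iff_has_inverse.1 hF
  let Ψ : D ⥤ C :=
    { obj := i
      map := fun {X Y} f => F.preimage (eqToHom (hr X) ≫ f ≫ eqToHom (hr Y).symm)
      map_id := fun X => F.map_injective (by simp)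
      map_comp := fun f g => F.map_injective (by simp) }
  refine ⟨Ψ, CategoryTheory.Functor.ext hl fun X Y f => F.map_injective ?_,
    CategoryTheory.Functor.ext hr fun X Y f => ?_⟩
  · simp [Ψ, eqToHom_map]
  · simp [Ψ]

/-! ### Ext along an adjunction -/

section

universe v

variable {A B : Type*} [Category.{v} A] [Category.{v} B] [Abelian A] [Abelian B]
  {R : Type*} [Ring R] [Linear R A] [Linear R B] {F : A ⥤ B} {H : B ⥤ A} (adj : F ⊣ H)
  [F.Additive] [H.Additive] [H.Linear R]

/-- The hom-set bijection of an adjunction with linear right adjoint is linear. -/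
def adjHomLinearEquiv (X : A) (Y : B) : (F.obj X ⟶ Y) ≃ₗ[R] (X ⟶ H.obj Y) :=
  { adj.homEquiv X Y with
    map_add' := fun f g => by simp [Adjunction.homEquiv_unit]
    map_smul' := fun r f => by simp [Adjunction.homEquiv_unit, Functor.map_smul] }

/-- The cochain complexes of homomorphisms on both sides of an adjunction agree. -/
def linearYonedaObjAdjIso (X : ChainComplex A ℕ) (Y : B) :
    ChainComplex.linearYonedaObj ((F.mapHomologicalComplex _).obj X) R Y ≅
      X.linearYonedaObj R (H.obj Y) :=
  HomologicalComplex.Hom.isoOfComponents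
    (fun i => (adjHomLinearEquiv (R := R) adj (X.X i) Y).toModuleIso) (by
      intro i j _
      ext f
      exact (adj.homEquiv_naturality_left (X.d j i) f).symm)

/-- Passing to a right adjoint in the second variable of `Ext`. -/
def extAdjIso [EnoughProjectives B] [F.PreservesHomology] [F.PreservesProjectiveObjects]
    {X : A} (P : ProjectiveResolution X) (Y : B) (n : ℕ) :
    ((Ext R B n).obj (op (F.obj X))).obj Y ≅
      (P.complex.linearYonedaObj R (H.obj Y)).homology n :=
  -- `F` is exact and preserves projectives, so the image of `P` is a projective resolution of
  -- `F.obj X` and computes `Ext`.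
  (F.mapProjectiveResolution P).isoExt n Y ≪≫
    (HomologicalComplex.homologyFunctor _ _ n).mapIso (linearYonedaObjAdjIso adj P.complex Y)

end

/-- Cohomology over a category with a right adjoint functor to another one. -/
def extWhiskerIso {C D : Type u} [SmallCategory C] [SmallCategory D] {R : Type u} [CommRing R]
    {J : C ⥤ D} {T : D ⥤ C} (adj : J ⊣ T) (P : ProjectiveResolution (constR R C))
    (N : D ⥤ ModuleCat.{u} R) (n : ℕ) :
    ((Ext R (D ⥤ ModuleCat.{u} R) n).obj (op (constR R D))).obj N ≅
      (P.complex.linearYonedaObj R (J ⋙ N)).homology n :=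
  -- The adjunction reverses: precomposition with `T` is left adjoint to precomposition with `J`.
  -- The latter preserves epimorphisms, so the former preserves projectives; it sends the constant
  -- functor to the constant functor by definition.
  let a := adj.whiskerLeft (ModuleCat.{u} R)
  have : ((Functor.whiskeringLeft D C (ModuleCat.{u} R)).obj T).PreservesProjectiveObjects :=
    ⟨fun hX => a.map_projective _ hX⟩
  have : ((Functor.whiskeringLeft C D (ModuleCat.{u} R)).obj J).Linear R := { }
  extAdjIso a P N n

/-! ### Homology of augmented complexes -/

/-- In positive degrees, the homology of an augmented complex is that of the complex. -/
def augmentHomologyIso {R : Type u} [Ring R] (K : CochainComplex (ModuleCat.{u} R) ℕ)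
    {X : ModuleCat.{u} R} (f : X ⟶ K.X 0) (w : f ≫ K.d 0 1 = 0) (n : ℕ) :
    (K.augment f w).homology (n + 2) ≅ K.homology (n + 1) :=
  (ShortComplex.homologyMapIso
    ((K.augment f w).isoSc' (n + 1) (n + 2) (n + 3) (by simp) (by simp))) ≪≫
  -- From position `n + 1 ≥ 1` on, the augmented complex is by definition `K` shifted by one.
  (show ((K.augment f w).sc' (n + 1) (n + 2) (n + 3)).homology ≅
      (K.sc' n (n + 1) (n + 2)).homology from Iso.refl _) ≪≫
  (ShortComplex.homologyMapIso (K.isoSc' n (n + 1) (n + 2) (by simp) (by simp))).symm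

/-- The cohomology in degree `0` of an augmented complex is the kernel of the augmentation. -/
def augmentHomologyZeroIso {R : Type u} [Ring R] (K : CochainComplex (ModuleCat.{u} R) ℕ)
    {X : ModuleCat.{u} R} (f : X ⟶ K.X 0) (w : f ≫ K.d 0 1 = 0) :
    (K.augment f w).homology 0 ≅ kernel f :=
  (CochainComplex.isoHomologyπ₀ _).symm ≪≫
    ((K.augment f w).cyclesIsKernel 0 1 (by simp)).conePointUniqueUpToIso (limit.isLimit _)

/-- The cohomology in degree `1` of an augmented complex is the cokernel of the augmentation, as a
map to the kernel of the first differential. -/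
def augmentHomologyOneIso {R : Type u} [Ring R] (K : CochainComplex (ModuleCat.{u} R) ℕ)
    {X Z : ModuleCat.{u} R} (f : X ⟶ K.X 0) (w : f ≫ K.d 0 1 = 0) (i : Z ⟶ K.X 0)
    (wi : i ≫ K.d 0 1 = 0) (hi : IsLimit (KernelFork.ofι i wi)) (r : X ⟶ Z) (hr : r ≫ i = f) :
    (K.augment f w).homology 1 ≅ cokernel r :=
  (ShortComplex.homologyMapIso
    ((K.augment f w).isoSc' 0 1 2 (by simp) (by simp))) ≪≫
  ShortComplex.LeftHomologyData.homologyIso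
    (S := ShortComplex.mk f (K.d 0 1) w)
    -- Any kernel of the differential serves as the module of cycles, so the homology is the
    -- cokernel of the factorization `r` of the incoming map through `Z`.
    { K := Z
      H := cokernel r
      i := i
      π := cokernel.π r
      wi := wi
      hi := hi
      wπ := by
        have : hi.lift (KernelFork.ofι f w) = r :=
          Fork.IsLimit.hom_ext hi ((hi.fac _ WalkingParallelPair.zero).trans hr.symm)
        erw [this]
        exact cokernel.condition r
      hπ := by
        have : hi.lift (KernelFork.ofι f w) = r :=
          Fork.IsLimit.hom_ext hi ((hi.fac _ WalkingParallelPair.zero).trans hr.symm)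
        subst this
        exact cokernelIsCokernel _ }

/-! ### Socles of sections -/

section

open Sec

variable {p : ℕ} {G : Type u} [Group G]

/-- A nontrivial normal subgroup of a finite `p`-group contains a central element of order `p`. -/
theorem exists_central_mem [Fact p.Prime] [Finite G] (hG : IsPGroup p G) {N : Subgroup G}
    [N.Normal] (hN : N ≠ ⊥) : ∃ x ∈ N, x ≠ 1 ∧ x ^ p = 1 ∧ ∀ u, u * x = x * u := by
  have : Nontrivial N := (Subgroup.nontrivial_iff_ne_bot _).2 hN
  have hp : p ∣ Nat.card N := (hG.to_subgroup N).card_eq_or_dvd.resolve_left fun h =>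
    (Finite.one_lt_card (α := N)).ne' h
  have hC : IsPGroup p (ConjAct G) := hG
  -- The number of fixed points of the conjugation action on `N` is divisible by `p`, so `1` is not
  -- the only one.
  obtain ⟨b, hb, hb1⟩ := hC.exists_fixed_point_of_prime_dvd_card_of_fixed_point N hp
    (a := 1) fun g => Subtype.ext (by simp)
  have hb1' : (b : G) ≠ 1 := fun h => hb1 (Subtype.ext h.symm)
  have hcomm : ∀ u : G, Commute u b := fun u => by
    have := congrArg Subtype.val (hb (ConjAct.toConjAct u))
    rw [ConjAct.Subgroup.val_conj_smul, ConjAct.smul_def, ConjAct.ofConjAct_toConjAct] at this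
    exact mul_inv_eq_iff_eq_mul.1 this
  -- With `orderOf b = p * k`, the power `b ^ k` has order `p` and is still central.
  obtain ⟨k, hk⟩ := hG.dvd_orderOf hb1'
  have h0 : 0 < orderOf (b : G) := orderOf_pos _
  refine ⟨(b : G) ^ k, pow_mem b.2 k, fun h => ?_, ?_, fun u => (hcomm u).pow_right k⟩
  · have hk0 : 0 < k := Nat.pos_of_ne_zero fun h => by rw [h, mul_zero] at hk; omega
    have := orderOf_le_of_pow_eq_one hk0 h
    have hp2 := (Fact.out : p.Prime).two_le
    nlinarith
  · rw [← pow_mul, mul_comm, ← hk, pow_orderOf_eq_one]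

namespace QuillenCat

/-- `B` is the group of the elements of `V` of order dividing `p` that are centralized by `U`. -/
def IsSocle (S : Sec G) (B : QuillenCat p G) : Prop :=
  ∀ x, x ∈ B.E ↔ x ∈ S.V ∧ x ^ p = 1 ∧ ∀ u ∈ S.U, u * x = x * u

/-- This special case of the hom-set bijection yields that `E ↦ (C_G(E), E)` is fully faithful. -/
theorem isSocle_centSec (B : QuillenCat p G) : IsSocle B.centSec B := fun x =>
  ⟨fun hx => ⟨hx, B.elemAb.pow x hx, fun _ hu => (Subgroup.mem_centralizer_iff.1 hu x hx).symm⟩,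
    fun hx => hx.1⟩

/-- The subgroup of the elements of `V` of order dividing `p` that are centralized by `U`. -/
def socle (p : ℕ) (S : Sec G) : QuillenCat p G where
  E :=
    { carrier := {x | x ∈ S.V ∧ x ^ p = 1 ∧ ∀ u ∈ S.U, u * x = x * u}
      one_mem' := ⟨one_mem _, one_pow _, by simp⟩
      mul_mem' := fun {x y} hx hy =>
        ⟨mul_mem hx.1 hy.1, by
          -- The element `y` commutes with all of `U`, and `x ∈ V ≤ U`.
          rw [Commute.mul_pow (hy.2.2 x (S.le hx.1)), hx.2.1, hy.2.1, one_mul],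
          fun u hu => by rw [← mul_assoc, hx.2.2 u hu, mul_assoc, hy.2.2 u hu, mul_assoc]⟩
      inv_mem' := fun {x} hx =>
        ⟨inv_mem hx.1, by rw [inv_pow, hx.2.1, inv_one],
          fun u hu => (show Commute u x from hx.2.2 u hu).inv_right⟩ }
  elemAb := ⟨fun x hx y hy => hy.2.2 x (S.le hx.1), fun x hx => hx.2.1⟩

theorem isSocle_socle (S : Sec G) : IsSocle S (socle p S) := fun _ => Iff.rfl

/-- `V` is a nontrivial normal subgroup of the `p`-group `U`, so it contains an element of order `p`
that is central in `U`. This keeps the right adjoint within the nontrivial elementary abelian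
subgroups. -/
theorem socle_ne_bot [Fact p.Prime] [Finite G] (hG : IsPGroup p G) {S : Sec G} (hS : S.V ≠ ⊥) :
    (socle p S).E ≠ ⊥ := by
  have hU : IsPGroup p S.U := hG.to_subgroup _
  have hN : (S.V.subgroupOf S.U) ≠ ⊥ := by
    rw [Ne, Subgroup.subgroupOf_eq_bot, disjoint_iff, inf_eq_left.2 S.le]
    exact hS
  obtain ⟨x, hx, hx1, hxp, hxc⟩ := exists_central_mem hU hN
  intro h
  have : (x : G) ∈ (socle p S).E :=
    ⟨hx, congrArg Subtype.val hxp, fun u hu => congrArg Subtype.val (hxc ⟨u, hu⟩)⟩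
  rw [h] at this
  exact hx1 (Subtype.ext (Subgroup.mem_bot.1 this))

variable {S : Sec G} {A B : QuillenCat p G}

theorem IsSocle.conj_mem (hB : IsSocle S B) {g : G} (h : g • S ≤ A.centSec) {x : G}
    (hx : x ∈ A.E) : g⁻¹ * x * g ∈ B.E := by
  refine (hB _).2 ⟨mem_smul_V.1 (h.1 hx), ?_, fun u hu => ?_⟩
  · have := conj_pow (i := p) (a := g⁻¹) (b := x)
    rw [inv_inv] at this
    rw [this, A.elemAb.pow x hx]
    simp
  · have h1 : g * u * g⁻¹ ∈ A.centSec.U := h.2 (mem_smul_U.2 (by simpa [mul_assoc] using hu))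
    have h2 := Subgroup.mem_centralizer_iff.1 h1 x hx
    calc u * (g⁻¹ * x * g) = g⁻¹ * (g * u * g⁻¹ * x) * g := by group
      _ = g⁻¹ * (x * (g * u * g⁻¹)) * g := by rw [h2]
      _ = _ := by group

/-- If `B` is the socle of `S`, then `S ≼ (C_G(B), B)`: the socle lies in `V` and is centralized by
`U`. The claim thus reduces to the section `(C_G(B), B)`. -/
theorem IsSocle.smul_le (hB : IsSocle S B) {φ : A.E →* B.E} {g : G}
    (h : ∀ x : A.E, (φ x : G) = g * x * g⁻¹) : g⁻¹ • S ≤ A.centSec := by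
  refine le_trans' (smul_le_smul g⁻¹ ⟨fun x hx => ((hB x).1 hx).1, fun u hu => ?_⟩) (centSec_le h)
  exact Subgroup.mem_centralizer_iff.2 fun x hx => (((hB x).1 hx).2.2 u hu).symm

/-- The conjugation `x ↦ g⁻¹ x g` as a morphism of the Quillen category. -/
def conjHom (g : G) (h : ∀ x ∈ A.E, g⁻¹ * x * g ∈ B.E) : A ⟶ B :=
  ⟨{ toFun := fun x => ⟨g⁻¹ * x * g, h x x.2⟩
     map_one' := Subtype.ext (by simp)
     map_mul' := fun x y => Subtype.ext (by simp [mul_assoc]) }, g⁻¹, fun x => by simp⟩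

theorem hom_ext {φ ψ : A ⟶ B} (h : ∀ x, (φ.1 x : G) = ψ.1 x) : φ = ψ :=
  Subtype.ext (MonoidHom.ext fun x => Subtype.ext (h x))

/-- The morphism `x ↦ g⁻¹ x g` that is defined by a coset `C_G(E) g`. -/
def IsSocle.toHom (hB : IsSocle S B) : (S ⟶ A.centSec) → (A ⟶ B) :=
  Quotient.lift (fun g => conjHom g.1 fun _ hx => hB.conj_mem g.2 hx) (by
    rintro ⟨g, hg⟩ ⟨g', hg'⟩ ⟨m, hm, e⟩
    refine hom_ext fun x => ?_
    have h1 := Subgroup.mem_centralizer_iff.1 hm x x.2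
    change g⁻¹ * x * g = g'⁻¹ * x * g'
    dsimp only at e
    subst e
    calc g⁻¹ * x * g = g⁻¹ * (m⁻¹ * (m * x)) * g := by group
      _ = g⁻¹ * (m⁻¹ * (x * m)) * g := by rw [h1]
      _ = _ := by group)

theorem IsSocle.toHom_homOf (hB : IsSocle S B) {g : G} (h : g • S ≤ A.centSec) (x : A.E) :
    ((hB.toHom (homOf g h)).1 x : G) = g⁻¹ * x * g := rfl

/-- If `g` and `g'` induce the same map on `A`, then `g' g⁻¹` centralizes `A`, so the cosets agree.
A morphism `x ↦ h x h⁻¹` into the socle comes from the coset of `h⁻¹`. -/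
theorem IsSocle.toHom_bijective (hB : IsSocle S B) :
    Function.Bijective (hB.toHom (A := A)) := by
  constructor
  · rintro ⟨g, hg⟩ ⟨g', hg'⟩ e
    refine coset_eq hg hg' (m := g' * g⁻¹) (Subgroup.mem_centralizer_iff.2 fun x hx => ?_)
      (by simp)
    have e1 : g⁻¹ * x * g = g'⁻¹ * x * g' :=
      congrArg (fun φ : A ⟶ B => (φ.1 ⟨x, hx⟩ : G)) e
    calc x * (g' * g⁻¹) = g' * (g'⁻¹ * x * g') * g⁻¹ := by group
      _ = g' * (g⁻¹ * x * g) * g⁻¹ := by rw [e1]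
      _ = _ := by group
  · intro φ
    refine ⟨homOf (elt φ)⁻¹ (hB.smul_le (elt_spec φ)), hom_ext fun x => ?_⟩
    rw [toHom_homOf, elt_spec φ x, inv_inv]

/-- The morphisms `(U, V) ⟶ (C_G(E), E)` are the morphisms from `E` to the socle of `(U, V)`. -/
def IsSocle.homEquiv (hB : IsSocle S B) : (S ⟶ A.centSec) ≃ (A ⟶ B) :=
  Equiv.ofBijective _ hB.toHom_bijective

/-- Naturality in the elementary abelian group is all that is needed: the action of the right
adjoint on morphisms is then forced by the hom-set bijections. -/
theorem IsSocle.homEquiv_comp (hB : IsSocle S B) {A' : QuillenCat p G} (φ : A' ⟶ A)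
    (f : S ⟶ A.centSec) :
    hB.homEquiv (f ≫ ((toSec p G).map φ).unop) = φ ≫ hB.homEquiv f := by
  obtain ⟨⟨g, hg⟩, rfl⟩ := Quotient.exists_rep f
  refine hom_ext fun x => ?_
  change ((elt φ)⁻¹ * g)⁻¹ * x * ((elt φ)⁻¹ * g) = g⁻¹ * (φ.1 x) * g
  rw [elt_spec φ x]
  group

theorem homEquiv_toSec_map (φ : A ⟶ B) :
    (isSocle_centSec B).homEquiv ((toSec p G).map φ).unop = φ := by
  refine hom_ext fun x => ?_
  change ((elt φ)⁻¹)⁻¹ * x * (elt φ)⁻¹ = _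
  rw [elt_spec φ x, inv_inv]

end QuillenCat

open QuillenCat


/-! ### The category `𝒟ᶜ_G` -/

instance quillenToDCent_faithful : (quillenToDCent p G).Faithful where
  map_injective {A B} f g h := by
    have e : (toSec p G).map f.hom = (toSec p G).map g.hom :=
      congrArg (fun k : (quillenToDCent p G).obj A ⟶ (quillenToDCent p G).obj B => k.unop.hom.op) h
    ext1
    rw [← homEquiv_toSec_map f.hom, e, homEquiv_toSec_map]

instance quillenToDCent_full : (quillenToDCent p G).Full where
  map_surjective {A B} f := by
    refine ⟨ObjectProperty.homMk ((isSocle_centSec B.obj).homEquiv f.unop.hom), ?_⟩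
    apply Quiver.Hom.unop_inj
    ext1
    exact (isSocle_centSec B.obj).homEquiv.injective (homEquiv_toSec_map _)

/-- `E` is recovered as the second component of `(C_G(E), E)`. -/
theorem quillenToDCent_obj_bijective : Function.Bijective (quillenToDCent p G).obj := by
  constructor
  · rintro ⟨⟨E, hE⟩, h⟩ ⟨⟨E', hE'⟩, h'⟩ e
    obtain rfl : E = E' :=
      congrArg (fun X : (DCent p G)ᵒᵖ => X.unop.obj.V) e
    rfl
  · rintro ⟨⟨_, A, hA, rfl⟩⟩
    exact ⟨⟨A, hA⟩, rfl⟩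

/-! ### The adjunction between `𝒜_p(G)` and `(𝒟*_G)ᵒᵖ` -/

/-- The functor `𝒜_p(G) ⥤ (𝒟*_G)ᵒᵖ`, `E ↦ (C_G(E), E)`. -/
def quillenToDStar (p : ℕ) (G : Type u) [Group G] : Quillen p G ⥤ (DStar G)ᵒᵖ where
  obj A := op ⟨A.obj.centSec, A.property⟩
  map f := (ObjectProperty.homMk ((toSec p G).map f.hom).unop).op
  map_id A := by
    apply Quiver.Hom.unop_inj
    ext1
    exact congrArg Quiver.Hom.unop ((toSec p G).map_id A.obj)
  map_comp f g := by
    apply Quiver.Hom.unop_inj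
    ext1
    exact congrArg Quiver.Hom.unop ((toSec p G).map_comp f.hom g.hom)

/-- `(U, V) ↦ socle` as a map on the objects of `𝒟*_G`. -/
def socleObj [Fact p.Prime] [Finite G] (hG : IsPGroup p G) (S : (DStar G)ᵒᵖ) : Quillen p G :=
  ⟨socle p S.unop.obj, socle_ne_bot hG S.unop.property⟩

/-- The hom-set bijection of the adjunction between `𝒜_p(G)` and `(𝒟*_G)ᵒᵖ`. -/
def quillenHomEquiv [Fact p.Prime] [Finite G] (hG : IsPGroup p G) (A : Quillen p G)
    (S : (DStar G)ᵒᵖ) : ((quillenToDStar p G).obj A ⟶ S) ≃ (A ⟶ socleObj hG S) where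
  toFun f := ObjectProperty.homMk ((isSocle_socle S.unop.obj).homEquiv f.unop.hom)
  invFun φ := (ObjectProperty.homMk ((isSocle_socle S.unop.obj).homEquiv.symm φ.hom)).op
  left_inv f := by
    apply Quiver.Hom.unop_inj
    ext1
    exact (isSocle_socle S.unop.obj).homEquiv.symm_apply_apply _
  right_inv φ := by
    ext1
    exact (isSocle_socle S.unop.obj).homEquiv.apply_symm_apply _

theorem quillenHomEquiv_naturality [Fact p.Prime] [Finite G] (hG : IsPGroup p G)
    (A' A : Quillen p G) (S : (DStar G)ᵒᵖ) (φ : A' ⟶ A) (f : (quillenToDStar p G).obj A ⟶ S) :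
    quillenHomEquiv hG A' S ((quillenToDStar p G).map φ ≫ f) = φ ≫ quillenHomEquiv hG A S f := by
  ext1
  exact (isSocle_socle S.unop.obj).homEquiv_comp φ.hom f.unop.hom

/-- The functor `E ↦ (C_G(E), E)` from `𝒜_p(G)` to `(𝒟*_G)ᵒᵖ` has a right adjoint. -/
def quillenAdjunction [Fact p.Prime] [Finite G] (hG : IsPGroup p G) :
    quillenToDStar p G ⊣
      Adjunction.rightAdjointOfEquiv (quillenHomEquiv hG) (quillenHomEquiv_naturality hG) :=
  Adjunction.adjunctionOfEquivRight _ _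

end

open Sec QuillenCat

/-! ### Cohomology in low degrees -/

section

variable {R : Type u} [CommRing R] {C : Type u} [SmallCategory C]

/-- The natural transformation from the constant functor that is given by an element of the
limit. -/
def constHom (N : C ⥤ ModuleCat.{u} R) (x : (limit N : ModuleCat.{u} R)) : constR R C ⟶ N where
  app c := ModuleCat.ofHom (LinearMap.toSpanSingleton R (N.obj c) (limit.π N c x))
  naturality c d f := by
    ext
    change (1 : R) • limit.π N d x = N.map f ((1 : R) • limit.π N c x)
    rw [one_smul, one_smul, ← limit.w N f]
    rfl

/-- The limit as the module of homomorphisms from the constant functor. -/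
def limitHomEquiv (N : C ⥤ ModuleCat.{u} R) :
    (limit N : ModuleCat.{u} R) ≃ₗ[R] (constR R C ⟶ N) where
  toFun := constHom N
  map_add' x y := by
    ext c
    change (1 : R) • limit.π N c (x + y) = (1 : R) • limit.π N c x + (1 : R) • limit.π N c y
    rw [map_add, smul_add]
  map_smul' r x := by
    ext c
    change (1 : R) • limit.π N c (r • x) = r • (1 : R) • limit.π N c x
    rw [map_smul, one_smul, one_smul]
  -- A natural transformation from the constant functor is a cone with apex `R`; the image of `1`
  -- under the induced map is the element of the limit.
  invFun t := limit.lift N ⟨ModuleCat.of R R, t⟩ (1 : R)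
  left_inv x := by
    refine Concrete.limit_ext N _ _ fun c => ?_
    rw [← ConcreteCategory.comp_apply, limit.lift_π]
    exact one_smul R _
  right_inv t := by
    ext c
    change (1 : R) • limit.π N c (limit.lift N ⟨ModuleCat.of R R, t⟩ (1 : R)) = t.app c (1 : R)
    rw [one_smul, ← ConcreteCategory.comp_apply, limit.lift_π]

/-- The map `Hom(R, N) ⟶ Hom(P₀, N)` of a projective resolution `P` of the constant functor. -/
def precompε (P : ProjectiveResolution (constR R C)) (N : C ⥤ ModuleCat.{u} R) :
    (constR R C ⟶ N) →ₗ[R] (P.complex.X 0 ⟶ N) :=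
  Linear.leftComp R N (X := P.complex.X 0) (Y := constR R C) (P.π.f 0)

theorem precompε_injective (P : ProjectiveResolution (constR R C)) (N : C ⥤ ModuleCat.{u} R) :
    Function.Injective (precompε P N) := fun _ _ h =>
  (cancel_epi (P.π.f 0)).1 h

theorem d_comp_precompε (P : ProjectiveResolution (constR R C)) (N : C ⥤ ModuleCat.{u} R)
    (t : constR R C ⟶ N) : P.complex.d 1 0 ≫ precompε P N t = 0 :=
  (P.complex_d_comp_π_f_zero_assoc t).trans zero_comp

/-- The augmentation is the cokernel of `P₁ ⟶ P₀`, so a map that vanishes on the image of `P₁`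
factors through it. -/
theorem exists_precompε_eq (P : ProjectiveResolution (constR R C)) (N : C ⥤ ModuleCat.{u} R)
    (f : P.complex.X 0 ⟶ N) (hf : P.complex.d 1 0 ≫ f = 0) : ∃ t, precompε P N t = f :=
  ⟨P.isColimitCokernelCofork.desc (CokernelCofork.ofπ f hf),
    P.isColimitCokernelCofork.fac (CokernelCofork.ofπ f hf) WalkingParallelPair.one⟩

/-- The inclusion of the cocycles of degree `0` of the complex `Hom(P, N)`. -/
def cocyclesι (P : ProjectiveResolution (constR R C)) (N : C ⥤ ModuleCat.{u} R)
    {Z : ModuleCat.{u} R} (e : Z ≃ₗ[R] (constR R C ⟶ N)) :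
    Z ⟶ (P.complex.linearYonedaObj R N).X 0 :=
  ModuleCat.ofHom (X := Z) (Y := P.complex.X 0 ⟶ N) (precompε P N ∘ₗ e.toLinearMap)

theorem cocyclesι_comp_d (P : ProjectiveResolution (constR R C)) (N : C ⥤ ModuleCat.{u} R)
    {Z : ModuleCat.{u} R} (e : Z ≃ₗ[R] (constR R C ⟶ N)) :
    cocyclesι P N e ≫ (P.complex.linearYonedaObj R N).d 0 1 = 0 :=
  ModuleCat.hom_ext (LinearMap.ext fun x => d_comp_precompε P N (e x))

instance cocyclesι_mono (P : ProjectiveResolution (constR R C)) (N : C ⥤ ModuleCat.{u} R)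
    {Z : ModuleCat.{u} R} (e : Z ≃ₗ[R] (constR R C ⟶ N)) : Mono (cocyclesι P N e) :=
  (ModuleCat.mono_iff_injective _).2 ((precompε_injective P N).comp e.injective)

/-- The cocycles of degree `0` are the homomorphisms from the constant functor. -/
def cocyclesIsLimit (P : ProjectiveResolution (constR R C)) (N : C ⥤ ModuleCat.{u} R)
    {Z : ModuleCat.{u} R} (e : Z ≃ₗ[R] (constR R C ⟶ N)) :
    IsLimit (KernelFork.ofι (cocyclesι P N e) (cocyclesι_comp_d P N e)) :=
  have : Mono (ShortComplex.mk _ _ (cocyclesι_comp_d P N e)).f := cocyclesι_mono P N e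
  ((ShortComplex.moduleCat_exact_iff
    (ShortComplex.mk _ _ (cocyclesι_comp_d P N e))).2 fun f hf => by
      obtain ⟨t, ht⟩ := exists_precompε_eq P N f hf
      exact ⟨e.symm t, (congrArg (precompε P N) (e.apply_symm_apply t)).trans ht⟩).fIsKernel

end

/-! ### The detection map as the augmentation -/

section

variable {p : ℕ} {G : Type u} [Group G] {R : Type u} [CommRing R]

theorem centSec_trivial_le : whole G ≤ (QuillenCat.trivial p G).centSec :=
  ⟨le_rfl, fun x _ => Subgroup.mem_centralizer_iff.2 fun y hy => by
    rw [Subgroup.mem_bot.1 (show y ∈ (⊥ : Subgroup G) from hy), one_mul, mul_one]⟩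

/-- The section `(G, 1)` is terminal in `𝒟_G`: the only coset of `G` is `G` itself. -/
theorem map_op_des (F : SecModule R G) {S T : Sec G} (f : S ⟶ T)
    (x : F.obj (op (whole G))) :
    F.map f.op (des F (le_whole T) x) = des F (le_whole S) x := by
  obtain ⟨⟨g, hg⟩, rfl⟩ := Quotient.exists_rep f
  exact map_homOf_comp F hg _ _ (m := g⁻¹) (Subgroup.mem_top _) (by simp) x

/-- The homomorphism from the constant functor of `𝒜'_p(G)` to `F̄` that is given by an element of
`F(G)`. -/
def wholeHom (p : ℕ) (F : SecModule R G) (x : F.obj (op (whole G))) :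
    constR R (QuillenCat p G) ⟶ bar p F where
  app A := ModuleCat.ofHom
    (LinearMap.toSpanSingleton R (F.obj (op A.centSec)) (des F (le_whole _) x))
  naturality A B φ := by
    ext
    change (1 : R) • des F _ x = F.map ((toSec p G).map φ) ((1 : R) • des F _ x)
    rw [one_smul, one_smul]
    exact (map_op_des F ((toSec p G).map φ).unop x).symm

/-- The trivial subgroup is initial in `𝒜'_p(G)`, so the homomorphisms from the constant functor of
`𝒜'_p(G)` to `F̄` are the elements of `F(G)`. -/
def wholeHomEquiv (p : ℕ) (F : SecModule R G) :
    F.obj (op (whole G)) ≃ₗ[R] (constR R (QuillenCat p G) ⟶ bar p F) where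
  toFun := wholeHom p F
  map_add' x y := by
    ext A
    change (1 : R) • des F _ (x + y) = (1 : R) • des F _ x + (1 : R) • des F _ y
    rw [map_add, smul_add]
  map_smul' r x := by
    ext A
    change (1 : R) • des F _ (r • x) = r • (1 : R) • des F _ x
    rw [map_smul, one_smul, one_smul]
  -- Evaluation at the trivial subgroup lands in `F(C_G(1) / 1)`. The sections `(C_G(1), 1)` and
  -- `(G, 1)` coincide, but not by definition, so a destriction between them is inserted.
  invFun t := des F centSec_trivial_le (t.app (QuillenCat.trivial p G) (1 : R))
  left_inv x := by
    change des F _ ((1 : R) • des F _ x) = x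
    rw [one_smul]
    refine (map_op_des F (incl centSec_trivial_le) x).trans ?_
    exact congrArg (fun k => k x) (F.map_id (op (whole G)))
  right_inv t := by
    ext A
    change (1 : R) • des F _ (des F _ (t.app (QuillenCat.trivial p G) (1 : R))) = t.app A (1 : R)
    rw [one_smul]
    let φ : QuillenCat.trivial p G ⟶ A :=
      conjHom 1 fun x hx => by
        rw [Subgroup.mem_bot.1 (show x ∈ (⊥ : Subgroup G) from hx)]
        simp
    have h := congrArg (fun k => k (1 : R)) (t.naturality φ)
    refine Eq.trans ?_ h.symm
    -- The chosen element `elt φ` can be anything, since every `g` induces the map from the trivial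
    -- subgroup; it is absorbed by the coset of `C_G(1) = G`.
    refine map_homOf_comp F _ _ _ (m := (elt φ)⁻¹) ?_ (by simp) _
    exact centSec_trivial_le.2 (Subgroup.mem_top _)

/-- The limit of `F` over `𝒟*_G` as the homomorphisms over the Quillen category. -/
def limitQuillenHomEquiv [Fact p.Prime] [Finite G] (hG : IsPGroup p G) (F : SecModule R G) :
    (limit (DStar.res F) : ModuleCat.{u} R) ≃ₗ[R]
      (constR R (Quillen p G) ⟶ Quillen.ι p G ⋙ bar p F) :=
  have : ((Functor.whiskeringLeft (Quillen p G) (DStar G)ᵒᵖ (ModuleCat.{u} R)).obj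
    (quillenToDStar p G)).Linear R := { }
  -- The left adjoint takes the constant functor of `𝒜_p(G)` to that of `(𝒟*_G)ᵒᵖ`, and the right
  -- adjoint takes the restriction of `F` to the restriction of `F̄`, both by definition.
  (limitHomEquiv (DStar.res F)).trans
    (adjHomLinearEquiv (R := R) ((quillenAdjunction hG).whiskerLeft (ModuleCat.{u} R))
      (constR R (Quillen p G)) (DStar.res F))

/-- At every `E`, both homomorphisms send `1` to the destriction of `x` to `C_G(E) / E`. -/
theorem limitQuillenHomEquiv_detect [Fact p.Prime] [Finite G] (hG : IsPGroup p G)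
    (F : SecModule R G) (x : F.obj (op (whole G))) :
    limitQuillenHomEquiv hG F (DStar.detect F x) =
      Functor.whiskerLeft (Quillen.ι p G) (wholeHom p F x) := by
  ext A
  refine (one_smul R _).trans (Eq.trans ?_ (one_smul R _).symm)
  exact congrArg (fun k => k x)
    (limit.lift_π (DStar.cone F) ((quillenToDStar p G).obj A))

/-- The isomorphism from `F(G)` to the term of degree `-1` of the augmented complex. -/
def wholeIso (p : ℕ) (F : SecModule R G) :
    F.obj (op (whole G)) ≅ ModuleCat.of R (constR R (QuillenCat p G) ⟶ bar p F) :=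
  (wholeHomEquiv p F).toModuleIso

theorem wholeIso_comp_augmentation [Fact p.Prime] [Finite G] (hG : IsPGroup p G)
    (F : SecModule R G) :
    (wholeIso p F).hom ≫ Quillen.augmentation (bar p F) =
      DStar.detect F ≫ cocyclesι (Quillen.resolution R p G) _ (limitQuillenHomEquiv hG F) :=
  ModuleCat.hom_ext (LinearMap.ext fun x =>
    (congrArg (precompε (Quillen.resolution R p G) _)
      (limitQuillenHomEquiv_detect hG F x)).symm)

/-- The isomorphism of the reduced cohomologies in degree `-1`. -/
def kernelIso [Fact p.Prime] [Finite G] (hG : IsPGroup p G) (F : SecModule R G) :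
    kernel (DStar.detect F) ≅ (Quillen.augmentedComplex (bar p F)).homology 0 :=
  -- Neither the monomorphism after the detection map nor the isomorphism before the augmentation
  -- changes the kernel.
  (kernelCompMono _ _).symm ≪≫ kernelIsoOfEq (wholeIso_comp_augmentation hG F).symm ≪≫
    kernelIsIsoComp _ _ ≪≫ (augmentHomologyZeroIso _ _ _).symm

/-- The isomorphism of the reduced cohomologies in degree `0`. -/
def cokernelIso [Fact p.Prime] [Finite G] (hG : IsPGroup p G) (F : SecModule R G) :
    cokernel (DStar.detect F) ≅ (Quillen.augmentedComplex (bar p F)).homology 1 :=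
  (cokernelEpiComp (wholeIso p F).inv (DStar.detect F)).symm ≪≫
    (augmentHomologyOneIso _ _ _ _ (cocyclesι_comp_d _ _ _)
      (cocyclesIsLimit (Quillen.resolution R p G) _ (limitQuillenHomEquiv hG F)) _ (by
        rw [Category.assoc]
        exact (congrArg ((wholeIso p F).inv ≫ ·) (wholeIso_comp_augmentation hG F).symm).trans
          ((wholeIso p F).inv_hom_id_assoc (Quillen.augmentation (bar p F))))).symm

/-- The reduced cohomologies of `𝒟*_G` and of the Quillen category agree. -/
theorem nonempty_reducedCohomology_iso [Fact p.Prime] [Finite G] (hG : IsPGroup p G)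
    (F : SecModule R G) : ∀ n : ℤ, Nonempty
      (DStar.reducedCohomology F n ≅ Quillen.reducedCohomology (bar p F) n)
  | Int.negSucc 0 => ⟨kernelIso hG F⟩
  | Int.negSucc (_ + 1) => ⟨Iso.refl _⟩
  | Int.ofNat 0 => ⟨cokernelIso hG F⟩
  -- Degree `n + 1` is position `n + 2` of the augmented complex, beyond the influence of the
  -- augmentation.
  | Int.ofNat (n + 1) => ⟨extWhiskerIso (quillenAdjunction hG) (Quillen.resolution R p G)
      (DStar.res F) (n + 1) ≪≫ (augmentHomologyIso _ _ _ n).symm⟩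

end

/-! ### Gluing data -/

section

variable {G : Type u} [Group G] {R : Type u} [CommRing R]

/-- This makes `(U, V)` a destriction of `(N_G(V), V)`, so a gluing data extends to all of `𝒟*_G` by
destricting `f_V`. -/
theorem le_normSec (S : Sec G) : S ≤ normSec S.V :=
  ⟨le_rfl, fun u hu => Subgroup.mem_normalizer_iff.2 fun v =>
    ⟨fun hv => S.conj_mem hu hv, fun hv => by
      simpa [mul_assoc] using S.conj_mem (inv_mem hu) hv⟩⟩

theorem gluingData_map (F : SecModule R G) (f : gluingData F) {S T : DStar G} (φ : S ⟶ T) :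
    F.map φ.hom.op (des F (le_normSec T.obj) (f.1 ⟨T.obj.V, T.property⟩)) =
      des F (le_normSec S.obj) (f.1 ⟨S.obj.V, S.property⟩) := by
  obtain ⟨f, hf, hf'⟩ := f
  obtain ⟨⟨g, hg⟩, hφ⟩ := Quotient.exists_rep φ.hom
  rw [← hφ]
  -- With `S = (U, V)` and `T = (M, K)`, put `H = g V g⁻¹`. Then `K ≤ H ≤ M ≤ N_G(K)`, and `g • S`
  -- lies below `(N_G(H, K), H)`. There `f_K` and `f_H` have the same destriction, and `f_H` is the
  -- conjugate of `f_V` by `g`.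
  let K : {H : Subgroup G // H ≠ ⊥} := ⟨T.obj.V, T.property⟩
  let L : {H : Subgroup G // H ≠ ⊥} := ⟨S.obj.V, S.property⟩
  let H := conjSub g L
  have hT := (le_normSec T.obj).2
  have hKH : K.1 ≤ H.1 := hg.1
  have hH : H.1 ≤ Subgroup.normalizer (K.1 : Set G) :=
    fun x hx => hT (hg.2 ((g • S.obj).le hx))
  have h2 : g • S.obj ≤ normSec₂ H.1 K.1 hH :=
    ⟨le_rfl, le_inf (le_normSec (g • S.obj)).2 fun x hx => hT (hg.2 hx)⟩
  have hK2 : normSec₂ H.1 K.1 hH ≤ normSec K.1 := ⟨hKH, inf_le_right⟩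
  have hH2 : normSec₂ H.1 K.1 hH ≤ normSec H.1 := ⟨le_rfl, inf_le_left⟩
  have e1 : F.map (homOf g hg).op (des F (le_normSec T.obj) (f K)) =
      F.map (homOf g (le_trans' h2 hK2)).op (f K) :=
    map_homOf_comp F _ _ _ (one_mem _) (by simp) _
  have e2 : F.map (homOf g h2).op (des F hK2 (f K)) =
      F.map (homOf g (le_trans' h2 hK2)).op (f K) :=
    map_homOf_comp F _ _ _ (one_mem _) (by simp) _
  have e3 : F.map (homOf g h2).op (des F hH2 (f H)) =
      F.map (homOf g (le_trans' h2 hH2)).op (f H) :=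
    map_homOf_comp F _ _ _ (one_mem _) (by simp) _
  have e4 : F.map (homOf g (le_trans' h2 hH2)).op (conjMap F g (smul_normSec g L.1) (f L)) =
      des F (le_normSec S.obj) (f L) :=
    map_homOf_comp F _ _ _ (one_mem _) (by simp) _
  refine e1.trans (e2.symm.trans ?_)
  rw [hf' K H hKH hH, e3, ← e4, hf g L]

/-- The gluing data as a cone. -/
def gluingCone (F : SecModule R G) : Cone (DStar.res F) where
  pt := ModuleCat.of R (gluingData F)
  π :=
    { app := fun S => ModuleCat.ofHom ((des F (le_normSec S.unop.obj)).hom ∘ₗ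
        LinearMap.proj (⟨S.unop.obj.V, S.unop.property⟩ : {H : Subgroup G // H ≠ ⊥}) ∘ₗ
          (gluingData F).subtype)
      naturality := fun S T φ => by
        ext f
        exact (gluingData_map F f φ.unop).symm }

/-- The section `(N_G(H), H)` as an object of `𝒟*_G`. -/
def normObj (H : {H : Subgroup G // H ≠ ⊥}) : DStar G := ⟨normSec H.1, H.2⟩

theorem map_limit_π (F : SecModule R G) (x : (limit (DStar.res F) : ModuleCat.{u} R))
    {S T : DStar G} (φ : S ⟶ T) :
    F.map φ.hom.op (limit.π (DStar.res F) (op T) x) = limit.π (DStar.res F) (op S) x :=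
  congrArg (fun k => k x) (limit.w (DStar.res F) φ.op)

/-- The gluing data of an element of the limit. -/
def limitGluing (F : SecModule R G) (x : (limit (DStar.res F) : ModuleCat.{u} R)) :
    gluingData F :=
  ⟨fun H => limit.π (DStar.res F) (op (normObj H)) x,
    -- Conjugations and destrictions between these sections are morphisms of `𝒟*_G`, so both
    -- conditions on a gluing data are instances of compatibility in the limit.
    fun g H => map_limit_π F x (S := normObj (conjSub g H)) (T := normObj H)
      (ObjectProperty.homMk _),
    fun K H _ h =>
      (map_limit_π F x (S := ⟨normSec₂ H.1 K.1 h, H.2⟩) (T := normObj K)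
        (ObjectProperty.homMk _)).trans
      (map_limit_π F x (S := ⟨normSec₂ H.1 K.1 h, H.2⟩) (T := normObj H)
        (ObjectProperty.homMk _)).symm⟩

theorem gluingLift_apply (F : SecModule R G) (f : gluingData F) (S : DStar G) :
    limit.π (DStar.res F) (op S) (limit.lift _ (gluingCone F) f) =
      des F (le_normSec S.obj) (f.1 ⟨S.obj.V, S.property⟩) :=
  congrArg (fun k => k f) (limit.lift_π (gluingCone F) (op S))

/-- The module of gluing data is the limit over `𝒟*_G`. -/
def gluingIso (F : SecModule R G) : ModuleCat.of R (gluingData F) ≅ limit (DStar.res F) :=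
  LinearEquiv.toModuleIso
    { (limit.lift _ (gluingCone F)).hom with
      invFun := limitGluing F
      left_inv := fun f => Subtype.ext (funext fun H => by
        refine (gluingLift_apply F f (normObj H)).trans ?_
        exact congrArg (fun k => k (f.1 H)) (F.map_id (op (normSec H.1))))
      right_inv := fun x => by
        refine Concrete.limit_ext _ _ _ fun S => ?_
        refine (gluingLift_apply F (limitGluing F x) S.unop).trans ?_
        -- An element of the limit takes at `(U, V)` the destriction of its value at `(N_G(V), V)`.
        exact map_limit_π F x (S := S.unop) (T := normObj ⟨S.unop.obj.V, S.unop.property⟩)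
          (ObjectProperty.homMk _) }

theorem gluingMap_comp_gluingIso (F : SecModule R G) :
    ModuleCat.ofHom (gluingMap F) ≫ (gluingIso F).hom = DStar.detect F := by
  refine limit.hom_ext fun S => ?_
  ext x
  refine (gluingLift_apply F (gluingMap F x) S.unop).trans ?_
  refine (map_op_des F (incl (le_normSec S.unop.obj)) x).trans ?_
  exact (congrArg (fun k => k x) (limit.lift_π (DStar.cone F) S)).symm

/-- The obstruction group is the reduced cohomology of `𝒟*_G` in degree `0`. -/
def obstructionIso (F : SecModule R G) : obstructionGroup F ≅ cokernel (DStar.detect F) :=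
  (ModuleCat.cokernelIsoRangeQuotient (ModuleCat.ofHom (gluingMap F))).symm ≪≫
    cokernel.mapIso _ _ (Iso.refl _) (gluingIso F) (by
      rw [gluingMap_comp_gluingIso, Iso.refl_hom, Category.id_comp])

theorem nonempty_obstructionGroup_iso {p : ℕ} [Fact p.Prime] [Finite G] (hG : IsPGroup p G)
    (F : SecModule R G) :
    Nonempty (obstructionGroup F ≅ Quillen.reducedCohomology (bar p F) 0) :=
  ⟨obstructionIso F ≪≫ cokernelIso hG F⟩

end

end

end SectionGluing

theorem theorem1 (p : ℕ) [Fact p.Prime] (G : Type u) [Group G] [Finite G] (hG : IsPGroup p G) :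
    -- the functor `E ↦ (C_G(E), E)` is an isomorphism of categories from `𝒜_p(G)` to `(𝒟ᶜ_G)ᵒᵖ`
    (∃ Ψ : (DCent p G)ᵒᵖ ⥤ Quillen p G,
      quillenToDCent p G ⋙ Ψ = 𝟭 (Quillen p G) ∧ Ψ ⋙ quillenToDCent p G = 𝟭 (DCent p G)ᵒᵖ) ∧
    ∀ (R : Type u) [CommRing R],
      -- for every `R𝒟_G`-module `F`
      (∀ F : SecModule R G,
        (∀ n : ℤ, Nonempty
          (DStar.reducedCohomology F n ≅ Quillen.reducedCohomology (bar p F) n)) ∧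
        Nonempty (obstructionGroup F ≅ Quillen.reducedCohomology (bar p F) 0)) ∧
      -- in particular, for every destriction functor `M`
      (∀ (M : Type u) [AddCommGroup M] [Module R M] [Module (DesAlgebra R G) M]
        [IsScalarTower R (DesAlgebra R G) M],
        (∀ n : ℤ, Nonempty
          (DStar.reducedCohomology (destrictionModule (G := G) M R) n ≅
            Quillen.reducedCohomology (bar p (destrictionModule (G := G) M R)) n)) ∧
        Nonempty (obstructionGroup (destrictionModule (G := G) M R) ≅
          Quillen.reducedCohomology (bar p (destrictionModule (G := G) M R)) 0)) ∧
      -- and for every biset functor `B`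
      (∀ B : BisetFunctor R G,
        (∀ n : ℤ, Nonempty
          (DStar.reducedCohomology B.toSecModule n ≅
            Quillen.reducedCohomology (bar p B.toSecModule) n)) ∧
        Nonempty (obstructionGroup B.toSecModule ≅
          Quillen.reducedCohomology (bar p B.toSecModule) 0)) := by
  refine ⟨exists_strict_inverse _ quillenToDCent_obj_bijective, fun R _ =>
    ⟨fun F => ⟨nonempty_reducedCohomology_iso hG F, nonempty_obstructionGroup_iso hG F⟩,
      fun M _ _ _ _ =>
        ⟨nonempty_reducedCohomology_iso hG _, nonempty_obstructionGroup_iso hG _⟩,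
      fun B => ⟨nonempty_reducedCohomology_iso hG _, nonempty_obstructionGroup_iso hG _⟩⟩⟩
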